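/- **Theorem.** Consider simple undirected graphs $G=(V,E)$ with $n=|V|\ge 1$ vertices, $m=|E|$ edges, no isolated vertices, and average degree $d=2m/n$. Vertices carry distinct identifiers (natural numbers), and the set $V$ of identifiers is not known in advance. A randomized algorithm that knows $n$ accesses $G$ through the following queries, each of unit cost and answered with fresh independent randomness: $\mathbf{RandVert}()$ returns a uniformly random vertex; $\mathbf{RandNbr}(x)$ returns a uniformly random neighbor of $x$; $\mathbf{Degree}(x)$ returns $\deg(x)$; $\mathbf{Pair}(x,y)$ tells whether $\{x,y\}\in E$; $\mathbf{RandEdge}()$ returns a uniformly random edge. For $c\ge 1$, a $c$-approximation to $d$ is a number $\hat d$ with $d/c\le \hat d\le c\,d$. (a) There are constants $C>0$, $k\in\mathbb N$ and an algorithm, taking $n$ and $\varepsilon\in(0,1)$ as input, such that for every such graph $G$ on $n$ vertices, with probability $>0.99$ it outputs a $(1+\varepsilon)$-approximation to $d$ after at most $$C\,\varepsilon^{-2}(\log n)^k\,\min\bigl(d,\ (n/d)^{1/3}\bigr)$$ queries. In particular, with probability $>0.99$ it outputs a $(1+\varepsilon)$-approximation to $d$ after at most $C\,\varepsilon^{-2}(\log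 n)^k\, n^{1/4}$ queries. (b) For every constant $c\ge 1$ there are $\kappa>0$ and $n_0$ such that for all $n\ge n_0$ the following holds. If an algorithm, on every such graph on $n$ vertices, outputs with probability $>2/3$ a $c$-approximation to $d$ after at most $b$ queries, then $b\ge \kappa\, n^{1/4}$. This holds even if the set $V$ of identifiers is known to the algorithm, which then has to succeed only on the graphs with vertex set $V$. -/

import Mathlib

open scoped ENNReal

/-- Queries of the standard model together with random edge samples.  Vertices are named by
natural-number identifiers. -/
inductive Query where
  | randVert
  | randNbr (x : ℕ)
  | degree (x : ℕ)
  | pair (x y : ℕ)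
  | randEdge

/-- The type of answers to each query. -/
def Query.Answer : Query → Type
  | .randVert => ℕ
  | .randNbr _ => Option ℕ
  | .degree _ => ℕ
  | .pair _ _ => Bool
  | .randEdge => Sym2 ℕ

/-- What an algorithm does next: stop with an estimate, or make one query and continue from a
state that depends on the answer. -/
inductive QueryAction (S : Type) where
  | output (r : ℝ)
  | query (q : Query) (next : q.Answer → S)

/-- A randomized query algorithm.  Its memory is arbitrary, local computation and local coin
tosses are free, and it need not halt. -/
structure QueryAlgorithm where
  State : Type
  init : State
  step : State → PMF (QueryAction State)

/-- A (nonempty, finite, simple, undirected) input graph on the set `V` of vertex identifiers,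
without isolated vertices. -/
structure InputGraph (V : Finset ℕ) where
  nonempty : V.Nonempty
  graph : SimpleGraph V
  exists_adj : ∀ v, ∃ w, graph.Adj v w

noncomputable section

namespace InputGraph

variable {V : Finset ℕ} (G : InputGraph V)

open scoped Classical in
/-- The number `m` of edges. -/
def numEdges : ℕ := G.graph.edgeFinset.card

/-- The average degree `d = 2m/n`. -/
def avgDegree : ℝ := 2 * (G.numEdges : ℝ) / (V.card : ℝ)

open scoped Classical in
theorem edgeFinset_nonempty : G.graph.edgeFinset.Nonempty := by
  obtain ⟨v, hv⟩ := G.nonempty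
  obtain ⟨w, hw⟩ := G.exists_adj ⟨v, hv⟩
  exact ⟨s(⟨v, hv⟩, w), by simpa using hw⟩

open scoped Classical in
theorem neighborFinset_nonempty (v : V) : (G.graph.neighborFinset v).Nonempty := by
  obtain ⟨w, hw⟩ := G.exists_adj v
  exact ⟨w, by simpa using hw⟩

open scoped Classical in
/-- The distribution of the answer to a query.  Each query draws a fresh, independent answer.
Identifiers that do not name a vertex have no neighbors. -/
def oracle : (q : Query) → PMF q.Answer
  | .randVert => PMF.uniformOfFinset V G.nonempty
  | .randNbr x =>
      if hx : x ∈ V then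
        (PMF.uniformOfFinset (G.graph.neighborFinset ⟨x, hx⟩)
          (G.neighborFinset_nonempty ⟨x, hx⟩)).map fun y => some (y : ℕ)
      else PMF.pure none
  | .degree x => PMF.pure (if hx : x ∈ V then G.graph.degree ⟨x, hx⟩ else (0 : ℕ))
  | .pair x y =>
      PMF.pure (decide (∃ (hx : x ∈ V) (hy : y ∈ V), G.graph.Adj ⟨x, hx⟩ ⟨y, hy⟩))
  | .randEdge =>
      (PMF.uniformOfFinset G.graph.edgeFinset G.edgeFinset_nonempty).map
        (Sym2.map ((↑) : V → ℕ))

end InputGraph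

namespace QueryAlgorithm

/-- The outcome of running an algorithm from state `s` for at most `b` queries: `some r` if it
outputs `r` after making at most `b` queries, and `none` if it wants to make more queries. -/
def run (A : QueryAlgorithm) (O : (q : Query) → PMF q.Answer) :
    ℕ → A.State → PMF (Option ℝ)
  | 0, s => (A.step s).bind fun
      | .output r => PMF.pure (some r)
      | .query _ _ => PMF.pure none
  | b + 1, s => (A.step s).bind fun
      | .output r => PMF.pure (some r)
      | .query q next => (O q).bind fun a => A.run O b (next a)

/-- The probability that, on the input graph `G`, the algorithm makes at most `b` queries and
outputs a value in `[d / c, c * d]`, where `d` is the average degree of `G`. -/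
def approxProb (A : QueryAlgorithm) {V : Finset ℕ} (G : InputGraph V) (b : ℕ) (c : ℝ) : ℝ≥0∞ :=
  (A.run G.oracle b A.init).toOuterMeasure
    {o | ∃ r, o = some r ∧ G.avgDegree / c ≤ r ∧ r ≤ c * G.avgDegree}

end QueryAlgorithm

end

/-!
*Upper bound.* The average degree `d` is a ratio of two means in several ways: it is the reciprocal
of the mean of `1 / deg` at a random end of a random edge, and for every `τ` the vertices of degree
at most `τ` can be compared in vertex samples and edge samples, and the edges between vertices of
degree above `τ` in edge samples and pairs of edge ends. Each ratio is estimated by a test that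
gives up unless both sample sums are large enough to be reliable, so that a conclusive test is
accurate whichever it is, and the sample size is doubled until a test is conclusive. The first test
is conclusive with about `d` samples. With `τ` of order `√(n d / B)`, one of the other two is
conclusive with about `B = (n / d) ^ (1 / 3)` samples.

*Lower bound.* Join a hub to all other vertices, and hide `t` disjoint cliques of size `k ^ 2` among
the `n ≈ k ^ 4` vertices. For `t ≥ k` the average degree is of order `t`, while the answers hardly
depend on `t`: a random vertex is almost always outside of the cliques, a random edge is almost
always a fresh edge of a clique, and two of these edges lie in the same clique with probability
`1 / t` only. Hence one random process imitates the answers for `t = k` and for `t = C * k` alike,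
up to an error of `O(1 / k)` per query.
-/

noncomputable section

open scoped NNReal

section Expect

variable {α β : Type*}

/-- The expectation of a `[0, ∞]`-valued function under a probability mass function. It is a plain
sum, so that no measurable structure on `α` has to be chosen. -/
def expect (p : PMF α) (f : α → ℝ≥0∞) : ℝ≥0∞ := ∑' a, p a * f a

theorem expect_bind (p : PMF α) (k : α → PMF β) (f : β → ℝ≥0∞) :
    expect (p.bind k) f = expect p fun a => expect (k a) f := by
  simp only [expect, PMF.bind_apply, ← ENNReal.tsum_mul_right, ← ENNReal.tsum_mul_left]
  rw [ENNReal.tsum_comm]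
  simp only [mul_assoc]

theorem expect_pure (a : α) (f : α → ℝ≥0∞) : expect (PMF.pure a) f = f a := by
  classical
  rw [expect, tsum_eq_single a fun b hb => by simp [PMF.pure_apply, hb]]
  simp

theorem expect_map (p : PMF α) (g : α → β) (f : β → ℝ≥0∞) :
    expect (p.map g) f = expect p fun a => f (g a) := by
  simp only [PMF.map, expect_bind, Function.comp_apply, expect_pure]

theorem expect_uniformOfFinset (s : Finset α) (hs : s.Nonempty) (f : α → ℝ≥0∞) :
    expect (PMF.uniformOfFinset s hs) f = (s.card : ℝ≥0∞)⁻¹ * ∑ a ∈ s, f a := by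
  classical
  rw [expect, tsum_eq_sum fun a ha => by
    rw [PMF.uniformOfFinset_apply_of_notMem hs ha, zero_mul], Finset.mul_sum]
  exact Finset.sum_congr rfl fun a ha => by rw [PMF.uniformOfFinset_apply_of_mem hs ha]

theorem toOuterMeasure_bind (p : PMF α) (k : α → PMF β) (S : Set β) :
    (p.bind k).toOuterMeasure S = expect p fun a => (k a).toOuterMeasure S :=
  PMF.toOuterMeasure_bind_apply _ _ _

theorem expect_mono_of_support {p : PMF α} {f g : α → ℝ≥0∞} (h : ∀ a ∈ p.support, f a ≤ g a) :
    expect p f ≤ expect p g := by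
  refine ENNReal.tsum_le_tsum fun a => ?_
  by_cases ha : a ∈ p.support
  · gcongr
    exact h a ha
  · simp [(p.apply_eq_zero_iff a).2 ha]

theorem expect_mono {p : PMF α} {f g : α → ℝ≥0∞} (h : ∀ a, f a ≤ g a) :
    expect p f ≤ expect p g :=
  expect_mono_of_support fun a _ => h a

theorem expect_const (p : PMF α) (c : ℝ≥0∞) : (expect p fun _ => c) = c := by
  rw [expect, ENNReal.tsum_mul_right, p.tsum_coe, one_mul]

theorem expect_le_one (p : PMF α) {f : α → ℝ≥0∞} (h : ∀ a, f a ≤ 1) : expect p f ≤ 1 :=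
  (expect_mono h).trans_eq (expect_const p 1)

theorem expect_add (p : PMF α) (f g : α → ℝ≥0∞) :
    (expect p fun a => f a + g a) = expect p f + expect p g := by
  simp only [expect, mul_add, ENNReal.tsum_add]

theorem expect_sum {ι : Type*} (p : PMF α) (s : Finset ι) (f : ι → α → ℝ≥0∞) :
    (expect p fun a => ∑ i ∈ s, f i a) = ∑ i ∈ s, expect p (f i) := by
  simp only [expect, Finset.mul_sum]
  exact Summable.tsum_finsetSum fun _ _ => ENNReal.summable

theorem expect_const_mul (p : PMF α) (c : ℝ≥0∞) (f : α → ℝ≥0∞) :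
    (expect p fun a => c * f a) = c * expect p f := by
  simp only [expect, ← ENNReal.tsum_mul_left, mul_left_comm]

theorem expect_indicator_one (p : PMF α) (S : Set α) :
    expect p (S.indicator 1) = p.toOuterMeasure S := by
  rw [PMF.toOuterMeasure_apply, expect]
  exact tsum_congr fun a => by by_cases h : a ∈ S <;> simp [h]

theorem toOuterMeasure_le_one (p : PMF α) (S : Set α) : p.toOuterMeasure S ≤ 1 := by
  rw [← expect_indicator_one, ← expect_const p 1]
  exact expect_mono (Set.indicator_le_self' fun _ _ => zero_le)

theorem one_le_expect_add {p : PMF α} {f : α → ℝ≥0∞} {B : Set α} {δ : ℝ≥0∞}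
    (h : ∀ a ∉ B, 1 ≤ f a + δ) : 1 ≤ expect p f + (δ + p.toOuterMeasure B) := by
  rw [← expect_indicator_one, ← expect_const p δ, ← expect_add, ← expect_add]
  calc (1 : ℝ≥0∞) = expect p fun _ => 1 := (expect_const p 1).symm
    _ ≤ _ := expect_mono fun a => by
      by_cases ha : a ∈ B
      · simp only [Set.indicator_of_mem ha, Pi.one_apply, ← add_assoc, le_add_self]
      · simpa only [Set.indicator_of_notMem ha, add_zero] using h a ha

end Expect

/-- Query programs whose only local randomness is tossing fair coins. They are inductive, so every
execution terminates. -/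
inductive Prog (α : Type) : Type where
  | ret (a : α)
  | ask (q : Query) (next : q.Answer → Prog α)
  | toss (next : Bool → Prog α)

namespace Prog

variable {α β : Type}

/-- Sequential composition. -/
def bind : Prog α → (α → Prog β) → Prog β
  | ret a, k => k a
  | ask q next, k => ask q fun x => (next x).bind k
  | toss next, k => toss fun x => (next x).bind k

instance : Monad Prog where
  pure := ret
  bind := bind

/-- The distribution of the result when queries are answered by the oracle `O`. -/
def eval (O : (q : Query) → PMF q.Answer) : Prog α → PMF α
  | ret a => PMF.pure a
  | ask q next => (O q).bind fun x => (next x).eval O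
  | toss next => (PMF.uniformOfFintype Bool).bind fun x => (next x).eval O

/-- `p.CostLE c` says that the program `p` never makes more than `c` queries. -/
def CostLE : Prog α → ℕ → Prop
  | ret _, _ => True
  | ask _ _, 0 => False
  | ask _ next, c + 1 => ∀ x, (next x).CostLE c
  | toss next, c => ∀ x, (next x).CostLE c

section Eval

variable (O : (q : Query) → PMF q.Answer)

theorem eval_pure (a : α) : (pure a : Prog α).eval O = PMF.pure a := rfl

theorem eval_bind (p : Prog α) (k : α → Prog β) :
    (p >>= k).eval O = (p.eval O).bind fun a => (k a).eval O := by
  change (p.bind k).eval O = _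
  induction p with
  | ret a => simp only [bind, eval, PMF.pure_bind]
  | ask q next ih => simp only [bind, eval, PMF.bind_bind, ih]
  | toss next ih => simp only [bind, eval, PMF.bind_bind, ih]

theorem eval_map (f : α → β) (p : Prog α) : (f <$> p).eval O = (p.eval O).map f :=
  eval_bind O p _

end Eval

section Cost

theorem costLE_pure (a : α) (c : ℕ) : (pure a : Prog α).CostLE c := by
  cases c <;> trivial

theorem CostLE.mono {p : Prog α} : ∀ {c c' : ℕ}, p.CostLE c → c ≤ c' → p.CostLE c' := by
  induction p with
  | ret a => exact fun _ _ => costLE_pure a _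
  | ask q next ih =>
    rintro (_ | c) (_ | c') h hc
    · exact h
    · exact h.elim
    · omega
    · exact fun x => ih x (h x) (by omega)
  | toss next ih =>
    intro c c' h hc
    simp only [CostLE] at h ⊢
    exact fun x => ih x (h x) hc

theorem CostLE.bind {p : Prog α} {k : α → Prog β} {c' : ℕ} (hk : ∀ a, (k a).CostLE c') :
    ∀ {c : ℕ}, p.CostLE c → (p >>= k).CostLE (c + c') := by
  change ∀ {c : ℕ}, p.CostLE c → (p.bind k).CostLE (c + c')
  induction p with
  | ret a => exact fun _ => (hk a).mono (by omega)
  | ask q next ih =>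
    rintro (_ | c) h
    · exact h.elim
    · rw [Nat.add_right_comm]
      exact fun x => ih x (h x)
  | toss next ih =>
    intro c h
    simp only [CostLE, Prog.bind] at h ⊢
    exact fun x => ih x (h x)

theorem CostLE.map {p : Prog α} {c : ℕ} (h : p.CostLE c) (f : α → β) : (f <$> p).CostLE c :=
  h.bind (c' := 0) fun a => costLE_pure (f a) 0

end Cost

/-- The first step of a program, in which all coins up to the next query are tossed. -/
def step : Prog ℝ → PMF (QueryAction (Prog ℝ))
  | ret r => PMF.pure (.output r)
  | ask q next => PMF.pure (.query q next)
  | toss next => (PMF.uniformOfFintype Bool).bind fun x => (next x).step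

/-- The query algorithm that executes a program. Its state is what remains of the program. -/
def toAlgorithm (p : Prog ℝ) : QueryAlgorithm where
  State := Prog ℝ
  init := p
  step := step

end Prog

theorem QueryAlgorithm.toOuterMeasure_run_mono (A : QueryAlgorithm)
    (O : (q : Query) → PMF q.Answer) (S : Set ℝ) {b b' : ℕ} (h : b ≤ b') (s : A.State) :
    (A.run O b s).toOuterMeasure (some '' S) ≤ (A.run O b' s).toOuterMeasure (some '' S) := by
  induction b generalizing b' s with
  | zero =>
    cases b' with
    | zero => exact le_rfl
    | succ b' =>
      simp only [run, toOuterMeasure_bind]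
      refine expect_mono fun x => ?_
      cases x with
      | output r => exact le_rfl
      | query q next => simp
  | succ b ih =>
    obtain _ | b' := b'
    · omega
    simp only [run, toOuterMeasure_bind]
    refine expect_mono fun x => ?_
    cases x with
    | output r => exact le_rfl
    | query q next =>
      simp only [toOuterMeasure_bind]
      exact expect_mono fun a => ih (by omega) (next a)

namespace Prog

variable (O : (q : Query) → PMF q.Answer) (p₀ : Prog ℝ)

theorem run_pure (b : ℕ) (r : ℝ) :
    p₀.toAlgorithm.run O b (pure r : Prog ℝ) = PMF.pure (some r) := by
  change p₀.toAlgorithm.run O b (ret r) = _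
  cases b <;> simp only [QueryAlgorithm.run, toAlgorithm, step, PMF.pure_bind]

theorem run_ask (b : ℕ) (q : Query) (next : q.Answer → Prog ℝ) :
    p₀.toAlgorithm.run O (b + 1) (ask q next) =
      (O q).bind fun x => p₀.toAlgorithm.run O b (next x) := by
  simp only [QueryAlgorithm.run, toAlgorithm, step, PMF.pure_bind]

theorem run_toss (b : ℕ) (next : Bool → Prog ℝ) :
    p₀.toAlgorithm.run O b (toss next) =
      (PMF.uniformOfFintype Bool).bind fun x => p₀.toAlgorithm.run O b (next x) := by
  cases b <;> simp only [QueryAlgorithm.run, toAlgorithm, step, PMF.bind_bind]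

theorem expect_toOuterMeasure_run_le {α : Type} (S : Set ℝ) (b : ℕ) {p : Prog α}
    (k : α → Prog ℝ) {c : ℕ} (hp : p.CostLE c) :
    (expect (p.eval O) fun a => (p₀.toAlgorithm.run O b (k a)).toOuterMeasure (some '' S)) ≤
      (p₀.toAlgorithm.run O (c + b) (p >>= k)).toOuterMeasure (some '' S) := by
  change _ ≤ (p₀.toAlgorithm.run O (c + b) (p.bind k)).toOuterMeasure _
  induction p generalizing c with
  | ret a =>
    rw [eval, expect_pure]
    exact p₀.toAlgorithm.toOuterMeasure_run_mono O S (by omega) (k a)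
  | ask q next ih =>
    obtain _ | c := c
    · exact hp.elim
    rw [Nat.add_right_comm, bind, run_ask, eval, expect_bind, toOuterMeasure_bind]
    exact expect_mono fun x => ih x (hp x)
  | toss next ih =>
    simp only [CostLE] at hp
    rw [bind, run_toss, eval, expect_bind, toOuterMeasure_bind]
    exact expect_mono fun x => ih x (hp x)

/-- Runs the trials in a list until one of them returns an estimate. -/
def firstSome {ι : Type} (trial : ι → Prog (Option ℝ)) : List ι → Prog ℝ
  | [] => pure 0
  | i :: l => do
    match ← trial i with
    | some r => pure r
    | none => firstSome trial l

theorem one_le_toOuterMeasure_run_firstSome {ι : Type} {trial : ι → Prog (Option ℝ)}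
    {cost : ι → ℕ} {S : Set ℝ} {δ : ℝ≥0∞} {i₀ : ι}
    (hgood : ((trial i₀).eval O).toOuterMeasure (some '' S)ᶜ ≤ δ) (l₂ : List ι) {l₁ : List ι}
    (hi₀ : i₀ ∈ l₁) (hcost : ∀ i ∈ l₁, (trial i).CostLE (cost i))
    (hbad : ∀ i ∈ l₁, ((trial i).eval O).toOuterMeasure (some '' Sᶜ) ≤ δ) :
    1 ≤ (p₀.toAlgorithm.run O (l₁.map cost).sum
      (firstSome trial (l₁ ++ l₂))).toOuterMeasure (some '' S) + l₁.length * δ := by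
  induction l₁ with
  | nil => simp at hi₀
  | cons i l ih =>
    have hret : ∀ r ∈ S, (p₀.toAlgorithm.run O (l.map cost).sum
        (pure r : Prog ℝ)).toOuterMeasure (some '' S) = 1 := fun r hr => by
      simp [run_pure, hr]
    simp only [List.map_cons, List.sum_cons, List.cons_append, firstSome, List.length_cons,
      Nat.cast_succ, add_mul, one_mul]
    refine le_trans ?_ (add_le_add_left
      (expect_toOuterMeasure_run_le O p₀ S (l.map cost).sum _ (hcost i (by simp))) _)
    obtain rfl | hmem := List.mem_cons.1 hi₀
    · refine (one_le_expect_add fun o ho => ?_).trans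
        (add_le_add_right (add_le_add_right hgood _) _)
      obtain ⟨r, hr, rfl⟩ := not_not.1 ho
      simp only [hret r hr, le_self_add]
    · refine (one_le_expect_add fun o ho => ?_).trans
        (add_le_add_right (add_le_add_right (hbad i (by simp)) _) _)
      obtain _ | r := o
      · exact ih hmem (fun j hj => hcost j (by simp [hj])) fun j hj => hbad j (by simp [hj])
      · simp only [hret r (by simpa using ho), le_self_add]

end Prog

section Underdispersed

/-- The distribution `q` has mean `a` and variance at most `a`. -/
structure Underdispersed (q : PMF ℝ≥0) (a : ℝ≥0) : Prop where
  mean : expect q (fun x => (x : ℝ≥0∞)) = a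
  secondMoment_le : expect q (fun x => (x : ℝ≥0∞) ^ 2) ≤ a + (a : ℝ≥0∞) ^ 2

namespace Underdispersed

protected theorem pure (a : ℝ≥0) : Underdispersed (PMF.pure a) a where
  mean := by rw [expect_pure]
  secondMoment_le := by rw [expect_pure]; exact le_add_self

theorem map_of_le_one {α : Type*} {p : PMF α} {f : α → ℝ≥0} {a : ℝ≥0} (hf : ∀ x, f x ≤ 1)
    (h : (expect p fun x => (f x : ℝ≥0∞)) = a) : Underdispersed (p.map f) a where
  mean := by rw [expect_map, h]
  secondMoment_le := calc
    expect (p.map f) (fun x => (x : ℝ≥0∞) ^ 2) = expect p fun x => (f x : ℝ≥0∞) ^ 2 :=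
      expect_map _ _ _
    _ ≤ expect p fun x => (f x : ℝ≥0∞) := expect_mono fun x => by
      exact_mod_cast pow_le_of_le_one zero_le (hf x) two_ne_zero
    _ ≤ a + (a : ℝ≥0∞) ^ 2 := h.le.trans le_self_add

theorem add {p q : PMF ℝ≥0} {a b : ℝ≥0} (hp : Underdispersed p a) (hq : Underdispersed q b) :
    Underdispersed (p.bind fun x => q.map (x + ·)) (a + b) where
  mean := by
    simp only [expect_bind, expect_map, ENNReal.coe_add, expect_add, expect_const, hp.mean,
      hq.mean]
  secondMoment_le := by
    have hsq : ∀ x y : ℝ≥0, ((x + y : ℝ≥0) : ℝ≥0∞) ^ 2 =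
        (x : ℝ≥0∞) ^ 2 + 2 * (x * y) + (y : ℝ≥0∞) ^ 2 := fun x y => by push_cast; ring
    calc expect (p.bind fun x => q.map (x + ·)) (fun x => (x : ℝ≥0∞) ^ 2)
        = expect p (fun x => (x : ℝ≥0∞) ^ 2) + 2 * (b * a) +
          expect q fun y => (y : ℝ≥0∞) ^ 2 := by
          simp only [expect_bind, expect_map, hsq, expect_add, expect_const_mul, expect_const,
            hq.mean, mul_comm _ (b : ℝ≥0∞), hp.mean]
      _ ≤ (a + (a : ℝ≥0∞) ^ 2) + 2 * (b * a) + (b + (b : ℝ≥0∞) ^ 2) :=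
          add_le_add (add_le_add hp.secondMoment_le le_rfl) hq.secondMoment_le
      _ = ((a + b : ℝ≥0) : ℝ≥0∞) + ((a + b : ℝ≥0) : ℝ≥0∞) ^ 2 := by push_cast; ring

theorem toOuterMeasure_le {q : PMF ℝ≥0} {a : ℝ≥0} (hq : Underdispersed q a) {θ : ℝ}
    (hθ : 0 < θ) :
    q.toOuterMeasure {x | θ ≤ |(x : ℝ) - a|} ≤ ENNReal.ofReal (a / θ ^ 2) := by
  lift θ to ℝ≥0 using hθ.le
  set S : Set ℝ≥0 := {x | (θ : ℝ) ≤ |(x : ℝ) - a|}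
  -- `θ² 1_S + 2 a x ≤ x² + a²` avoids the subtraction in `θ² 1_S ≤ (x - a)²`.
  have hpt (x : ℝ≥0) : (θ : ℝ≥0∞) ^ 2 * S.indicator 1 x + 2 * a * x ≤
      (x : ℝ≥0∞) ^ 2 + (a : ℝ≥0∞) ^ 2 := by
    by_cases hx : x ∈ S
    · have hle : (θ : ℝ) ^ 2 ≤ ((x : ℝ) - a) ^ 2 := by
        rw [← sq_abs ((x : ℝ) - a)]
        exact pow_le_pow_left₀ θ.coe_nonneg hx 2
      have : θ ^ 2 + 2 * a * x ≤ x ^ 2 + a ^ 2 := by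
        rw [← NNReal.coe_le_coe]
        push_cast
        linarith
      rw [Set.indicator_of_mem hx, Pi.one_apply, mul_one]
      exact_mod_cast this
    · rw [Set.indicator_of_notMem hx, mul_zero, zero_add]
      exact_mod_cast two_mul_le_add_sq a x |>.trans_eq (add_comm _ _)
  have hE := (expect_mono (p := q) hpt).trans_eq (expect_add _ _ _)
  simp only [expect_add, expect_const_mul, expect_const, expect_indicator_one, hq.mean] at hE
  have hmul : (θ : ℝ≥0∞) ^ 2 * q.toOuterMeasure S ≤ a := by
    have htop : 2 * (a : ℝ≥0∞) * a ≠ ∞ := by finiteness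
    refine (ENNReal.add_le_add_iff_right htop).1 (hE.trans ?_)
    calc _ ≤ (a : ℝ≥0∞) + (a : ℝ≥0∞) ^ 2 + (a : ℝ≥0∞) ^ 2 :=
          add_le_add_left hq.secondMoment_le _
      _ = _ := by ring
  have hθ' : θ ≠ 0 := by rintro rfl; simp at hθ
  rw [show (a : ℝ) / (θ : ℝ) ^ 2 = ((a / θ ^ 2 : ℝ≥0) : ℝ) by push_cast; rfl,
    ENNReal.ofReal_coe_nnreal, ENNReal.coe_div (by positivity), ENNReal.coe_pow]
  exact ENNReal.le_div_iff_mul_le (by simp [hθ']) (by simp) |>.2 (mul_comm _ _ |>.trans_le hmul)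

end Underdispersed

end Underdispersed

namespace Prog

variable {O : (q : Query) → PMF q.Answer}

/-- The sum of the results of `N` independent executions. -/
def sumOf (p : Prog ℝ≥0) : ℕ → Prog ℝ≥0
  | 0 => pure 0
  | N + 1 => do
    let x ← p
    (x + ·) <$> sumOf p N

theorem CostLE.sumOf {p : Prog ℝ≥0} {c : ℕ} (h : p.CostLE c) (N : ℕ) :
    (p.sumOf N).CostLE (N * c) := by
  induction N with
  | zero => exact costLE_pure _ _
  | succ N ih =>
    rw [Nat.succ_mul, Nat.add_comm (N * c)]
    exact h.bind fun x => ih.map _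

theorem underdispersed_eval_sumOf {p : Prog ℝ≥0} {μ : ℝ≥0} (h : Underdispersed (p.eval O) μ)
    (N : ℕ) : Underdispersed ((p.sumOf N).eval O) (N * μ) := by
  induction N with
  | zero => simpa [sumOf, eval_pure] using Underdispersed.pure 0
  | succ N ih =>
    rw [Nat.cast_succ, add_one_mul, add_comm (N * μ)]
    simpa only [sumOf, eval_bind, eval_map] using h.add ih

end Prog

/-- The ways in which testing a sum `x` with mean `a` against the threshold `T` can fail: the sum
passes although its relative error exceeds `η`, or it does not pass although `2 T ≤ a`. -/
def testFailures (η T : ℝ) (a : ℝ≥0) : Set ℝ≥0 :=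
  {x | T ≤ x ∧ η * a < |(x : ℝ) - a| ∨ 2 * T ≤ a ∧ (x : ℝ) < T}

theorem Underdispersed.testFailures_le {q : PMF ℝ≥0} {a : ℝ≥0} (hq : Underdispersed q a)
    {η T : ℝ} (hη : 0 < η) (hη' : η ≤ 1 / 2) (hT : 0 < T) :
    q.toOuterMeasure (testFailures η T a) ≤ ENNReal.ofReal (2 / (η ^ 2 * T)) := by
  have hmono {θ : ℝ} (hθ : 0 < θ) (hsub : testFailures η T a ⊆ {x | θ ≤ |(x : ℝ) - a|})
      (hle : a / θ ^ 2 ≤ 2 / (η ^ 2 * T)) :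
      q.toOuterMeasure (testFailures η T a) ≤ ENNReal.ofReal (2 / (η ^ 2 * T)) :=
    (q.toOuterMeasure.mono hsub).trans <|
      (hq.toOuterMeasure_le hθ).trans (ENNReal.ofReal_le_ofReal hle)
  obtain h | h := le_or_gt (T / 2) a
  · have ha : 0 < (a : ℝ) := by linarith
    refine hmono (θ := η * a) (by positivity) ?_ ?_
    · rintro x (⟨-, hx⟩ | ⟨ha', hx⟩)
      · exact hx.le
      · exact (by nlinarith : η * a ≤ a - x).trans (abs_sub_comm (x : ℝ) a ▸ le_abs_self _)
    · calc (a : ℝ) / (η * a) ^ 2 = 1 / (η ^ 2 * a) := by field_simp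
        _ ≤ 1 / (η ^ 2 * (T / 2)) := by gcongr
        _ = 2 / (η ^ 2 * T) := by field_simp
  · refine hmono (θ := T / 2) (by positivity) ?_ ?_
    · rintro x (⟨hx, -⟩ | ⟨ha', -⟩)
      · exact (by linarith : T / 2 ≤ x - a).trans (le_abs_self _)
      · linarith
    · calc (a : ℝ) / (T / 2) ^ 2 ≤ (T / 2) / (T / 2) ^ 2 := by gcongr
        _ = 2 / (1 * T) := by field_simp
        _ ≤ 2 / (η ^ 2 * T) := by gcongr; nlinarith

theorem div_mem_Icc_of_abs_sub_le {ε a b x y : ℝ} (hε : 0 < ε) (hε1 : ε < 1) (hx : 0 < x)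
    (hy : 0 < y) (hxa : |x - a| ≤ ε / 4 * a) (hyb : |y - b| ≤ ε / 4 * b) :
    x / y ∈ Set.Icc (a / b / (1 + ε)) ((1 + ε) * (a / b)) := by
  obtain ⟨hxa₁, hxa₂⟩ := abs_le.1 hxa
  obtain ⟨hyb₁, hyb₂⟩ := abs_le.1 hyb
  have ha : 0 < a := by nlinarith
  have hb : 0 < b := by nlinarith
  have hab : (1 + ε / 4) * (a * b) ≤ (1 - ε / 4) * (1 + ε) * (a * b) := by
    gcongr
    nlinarith
  constructor
  · rw [div_div, div_le_div_iff₀ (by positivity) hy]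
    calc a * y ≤ a * ((1 + ε / 4) * b) := by gcongr; linarith
      _ ≤ (1 - ε / 4) * a * (b * (1 + ε)) := by linarith
      _ ≤ x * (b * (1 + ε)) := by gcongr; linarith
  · rw [← mul_div_assoc, div_le_div_iff₀ hy hb]
    calc x * b ≤ (1 + ε / 4) * a * b := by gcongr; linarith
      _ ≤ (1 + ε) * a * ((1 - ε / 4) * b) := by linarith
      _ ≤ (1 + ε) * a * y := by gcongr; linarith

/-- An estimator for a number of the form `scale * (μ / ν)`, where `μ` and `ν` are the means of
`num` and `den`. -/
structure RatioTest where
  num : Prog ℝ≥0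
  den : Prog ℝ≥0
  scale : ℝ

namespace RatioTest

/-- Samples `num` and `den` `N` times each, and gives up unless both sums reach `T`. -/
def prog (E : RatioTest) (N : ℕ) (T : ℝ) : Prog (Option ℝ) := do
  let x ← E.num.sumOf N
  let y ← E.den.sumOf N
  pure (open Classical in if T ≤ x ∧ T ≤ y then some (E.scale * (x / y)) else none)

/-- The test `E` estimates `d` when its queries are answered by `O`, and `μ`, `ν` are the means of
its two samples. -/
structure Estimates (E : RatioTest) (O : (q : Query) → PMF q.Answer) (μ ν : ℝ≥0) (d : ℝ) :
    Prop where
  num : Underdispersed (E.num.eval O) μ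
  den : Underdispersed (E.den.eval O) ν
  scale_nonneg : 0 ≤ E.scale
  scale_mul : 0 < μ → 0 < ν → E.scale * (μ / ν) = d

theorem costLE_prog {E : RatioTest} {c c' : ℕ} (hnum : E.num.CostLE c) (hden : E.den.CostLE c')
    (N : ℕ) (T : ℝ) : (E.prog N T).CostLE (N * (c + c')) := by
  rw [mul_add]
  exact (hnum.sumOf N).bind fun x => (hden.sumOf N).map _

variable {O : (q : Query) → PMF q.Answer} {E : RatioTest} {μ ν : ℝ≥0} {d : ℝ}

namespace Estimates

theorem toOuterMeasure_prog_le (h : E.Estimates O μ ν d) {η T : ℝ} (hη : 0 < η)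
    (hη' : η ≤ 1 / 2) (hT : 0 < T) (N : ℕ) {B : Set (Option ℝ)}
    (hB : ∀ x ∉ testFailures η T (N * μ), ∀ y ∉ testFailures η T (N * ν),
      (if T ≤ (x : ℝ) ∧ T ≤ (y : ℝ) then some (E.scale * (x / y)) else none) ∉ B) :
    ((E.prog N T).eval O).toOuterMeasure B ≤ ENNReal.ofReal (4 / (η ^ 2 * T)) := by
  set p := (E.num.sumOf N).eval O
  set q := (E.den.sumOf N).eval O
  set S := testFailures η T (N * μ)
  set R := testFailures η T (N * ν)
  have hp : p.toOuterMeasure S ≤ ENNReal.ofReal (2 / (η ^ 2 * T)) :=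
    (Prog.underdispersed_eval_sumOf h.num N).testFailures_le hη hη' hT
  have hq : q.toOuterMeasure R ≤ ENNReal.ofReal (2 / (η ^ 2 * T)) :=
    (Prog.underdispersed_eval_sumOf h.den N).testFailures_le hη hη' hT
  have hunion : ((E.prog N T).eval O).toOuterMeasure B ≤
      p.toOuterMeasure S + q.toOuterMeasure R := by
    simp only [prog, Prog.eval_bind, Prog.eval_pure, toOuterMeasure_bind]
    rw [← expect_indicator_one, ← expect_const p (q.toOuterMeasure R), ← expect_add]
    refine expect_mono fun x => ?_
    rw [← expect_indicator_one q, ← expect_const q (S.indicator 1 x), ← expect_add]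
    refine expect_mono fun y => ?_
    by_cases hx : x ∈ S
    · exact (toOuterMeasure_le_one _ _).trans (by simp [hx])
    by_cases hy : y ∈ R
    · exact (toOuterMeasure_le_one _ _).trans (by simp [hy])
    · rw [PMF.toOuterMeasure_pure_apply, if_neg]
      · exact zero_le
      · convert hB x hx y hy
  calc _ ≤ _ := hunion.trans (add_le_add hp hq)
    _ = ENNReal.ofReal (4 / (η ^ 2 * T)) := by
      rw [← ENNReal.ofReal_add (by positivity) (by positivity)]
      ring_nf

variable {ε T : ℝ}

theorem scale_mul_mem_Icc (h : E.Estimates O μ ν d) (hε : 0 < ε) (hε1 : ε < 1) (hT : 0 < T)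
    {N : ℕ} {x y : ℝ≥0} (hx : x ∉ testFailures (ε / 4) T (N * μ))
    (hy : y ∉ testFailures (ε / 4) T (N * ν)) (hTx : T ≤ x) (hTy : T ≤ y) :
    E.scale * (x / y) ∈ Set.Icc (d / (1 + ε)) ((1 + ε) * d) := by
  simp only [testFailures, Set.mem_ofPred_eq, not_or, not_and, not_lt] at hx hy
  have hx0 : 0 < (x : ℝ) := hT.trans_le hTx
  have hy0 : 0 < (y : ℝ) := hT.trans_le hTy
  have hNμ : 0 < (N * μ : ℝ≥0) := pos_iff_ne_zero.2 fun h0 => by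
    simpa [h0, hx0.not_ge] using hx.1 hTx
  have hNν : 0 < (N * ν : ℝ≥0) := pos_iff_ne_zero.2 fun h0 => by
    simpa [h0, hy0.not_ge] using hy.1 hTy
  have hN : (N : ℝ) ≠ 0 := by exact_mod_cast (left_ne_zero_of_mul hNμ.ne')
  have hratio := div_mem_Icc_of_abs_sub_le hε hε1 hx0 hy0 (hx.1 hTx) (hy.1 hTy)
  rw [← h.scale_mul (pos_of_mul_pos_right hNμ zero_le)
    (pos_of_mul_pos_right hNν zero_le)]
  push_cast [mul_div_mul_left _ _ hN] at hratio
  rw [mul_div_assoc, mul_left_comm]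
  exact ⟨mul_le_mul_of_nonneg_left hratio.1 h.scale_nonneg,
    mul_le_mul_of_nonneg_left hratio.2 h.scale_nonneg⟩

theorem toOuterMeasure_bad_le (h : E.Estimates O μ ν d) (hε : 0 < ε) (hε1 : ε < 1) (hT : 0 < T)
    (N : ℕ) : ((E.prog N T).eval O).toOuterMeasure
      (some '' (Set.Icc (d / (1 + ε)) ((1 + ε) * d))ᶜ) ≤
        ENNReal.ofReal (4 / ((ε / 4) ^ 2 * T)) := by
  refine h.toOuterMeasure_prog_le (by positivity) (by linarith) hT N fun x hx y hy => ?_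
  split_ifs with hxy
  · simpa using h.scale_mul_mem_Icc hε hε1 hT hx hy hxy.1 hxy.2
  · simp

theorem toOuterMeasure_compl_good_le (h : E.Estimates O μ ν d) (hε : 0 < ε) (hε1 : ε < 1)
    (hT : 0 < T) {N : ℕ} (hμ : 2 * T ≤ N * μ) (hν : 2 * T ≤ N * ν) :
    ((E.prog N T).eval O).toOuterMeasure
      (some '' Set.Icc (d / (1 + ε)) ((1 + ε) * d))ᶜ ≤
        ENNReal.ofReal (4 / ((ε / 4) ^ 2 * T)) := by
  refine h.toOuterMeasure_prog_le (by positivity) (by linarith) hT N fun x hx y hy => ?_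
  have hTx : T ≤ x := le_of_not_gt fun hlt => hx (.inr ⟨by exact_mod_cast hμ, hlt⟩)
  have hTy : T ≤ y := le_of_not_gt fun hlt => hy (.inr ⟨by exact_mod_cast hν, hlt⟩)
  rw [if_pos ⟨hTx, hTy⟩]
  simpa using h.scale_mul_mem_Icc hε hε1 hT hx hy hTx hTy

end Estimates

end RatioTest

namespace InputGraph

variable {V : Finset ℕ} (G : InputGraph V)

open scoped Classical in
/-- The degree of a vertex. -/
def deg (v : V) : ℕ := G.graph.degree v

open scoped Classical in
/-- The sum of a function over all ordered pairs of adjacent vertices. -/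
def dartSum {M : Type*} [AddCommMonoid M] (f : V → V → M) : M :=
  ∑ u, ∑ v, if G.graph.Adj u v then f u v else 0

theorem deg_pos (v : V) : 0 < G.deg v := by
  classical
  rw [deg, SimpleGraph.degree_pos_iff_exists_adj]
  exact G.exists_adj v

theorem sum_deg : ∑ v, G.deg v = 2 * G.numEdges := by
  classical
  exact G.graph.sum_degrees_eq_twice_card_edges

theorem numEdges_pos : 0 < G.numEdges := G.edgeFinset_nonempty.card_pos

theorem dartSum_fst {M : Type*} [AddCommMonoid M] (f : V → M) :
    (G.dartSum fun u _ => f u) = ∑ u, G.deg u • f u := by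
  classical
  refine Finset.sum_congr rfl fun u _ => ?_
  rw [← Finset.sum_filter, Finset.sum_const, deg, ← G.graph.card_neighborFinset_eq_degree,
    SimpleGraph.neighborFinset_eq_filter]

theorem dartSum_swap {M : Type*} [AddCommMonoid M] (f : V → V → M) :
    (G.dartSum fun u v => f v u) = G.dartSum f := by
  refine Finset.sum_comm.trans (Finset.sum_congr rfl fun u _ => Finset.sum_congr rfl fun v _ => ?_)
  classical exact if_congr (G.graph.adj_comm v u) rfl rfl

theorem coe_dartSum (f : V → V → ℝ≥0) :
    ((G.dartSum f : ℝ≥0) : ℝ≥0∞) = G.dartSum fun u v => (f u v : ℝ≥0∞) := by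
  simp only [dartSum, ENNReal.ofNNReal_finsetSum, apply_ite ((↑) : ℝ≥0 → ℝ≥0∞), ENNReal.coe_zero]

open scoped Classical in
theorem sum_edgeFinset_eq_dartSum {M : Type*} [AddCommMonoid M] (f : V → V → M) (F : Sym2 V → M)
    (hF : ∀ u v, F s(u, v) = f u v + f v u) : ∑ e ∈ G.graph.edgeFinset, F e = G.dartSum f := by
  rw [dartSum, ← Fintype.sum_prod_type' (f := fun u v => if G.graph.Adj u v then f u v else 0),
    ← Finset.sum_filter, ← Finset.sum_fiberwise_of_maps_to (t := G.graph.edgeFinset)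
    (g := fun x : V × V => s(x.1, x.2)) (fun x hx => by simpa using hx)]
  refine Finset.sum_congr rfl fun e he => ?_
  induction e with
  | _ u v =>
    have huv : G.graph.Adj u v := by simpa using he
    have hfib : {x ∈ ({x | G.graph.Adj x.1 x.2} : Finset (V × V)) | s(x.1, x.2) = s(u, v)} =
        {(u, v), (v, u)} := by
      ext ⟨x, y⟩
      simp only [Finset.mem_filter, Sym2.eq_iff, Finset.mem_insert,
        Finset.mem_singleton, Prod.mk.injEq]
      constructor
      · exact And.right
      · rintro (⟨rfl, rfl⟩ | ⟨rfl, rfl⟩) <;> simp [huv, huv.symm]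
    rw [hfib, Finset.sum_pair (by simp [huv.ne]), hF]

end InputGraph

namespace Prog

/-- Ask for a random vertex. -/
def randVert : Prog ℕ := ask .randVert ret

/-- Ask for the degree of `x`. -/
def degree (x : ℕ) : Prog ℕ := ask (.degree x) ret

/-- Ask whether `x` and `y` are adjacent. -/
def pair (x y : ℕ) : Prog Bool := ask (.pair x y) ret

/-- Ask for a random edge. -/
def randEdge : Prog (Sym2 ℕ) := ask .randEdge ret

/-- Toss a fair coin. -/
def coin : Prog Bool := toss ret

theorem expect_coin (O : (q : Query) → PMF q.Answer) (f : Bool → ℝ≥0∞) :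
    expect (coin.eval O) f = 2⁻¹ * (f true + f false) := by
  have heval : coin.eval O = PMF.uniformOfFintype Bool := PMF.bind_pure _
  simp [heval, expect, PMF.uniformOfFintype_apply, tsum_fintype, mul_add]

/-- What is recorded of an oriented edge: its origin, and the degrees of both ends. -/
structure DartSample where
  origin : ℕ
  originDeg : ℕ
  targetDeg : ℕ

/-- The origins of two darts: their degrees, and whether they are adjacent. -/
structure OriginPairSample where
  deg₁ : ℕ
  deg₂ : ℕ
  adj : Bool

/-- The degree of a random vertex. -/
def vertexDegree : Prog ℕ := do
  let v ← randVert
  degree v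

/-- A random edge with a random orientation. -/
def dart : Prog DartSample := do
  let e ← randEdge
  let b ← coin
  let a : ℕ × ℕ := if b then Quot.out e else (Quot.out e).swap
  let d₁ ← degree a.1
  let d₂ ← degree a.2
  pure ⟨a.1, d₁, d₂⟩

/-- The origins of two independent random darts. -/
def originPair : Prog OriginPairSample := do
  let x ← dart
  let y ← dart
  let b ← pair x.origin y.origin
  pure ⟨x.originDeg, y.originDeg, b⟩

theorem costLE_vertexDegree : vertexDegree.CostLE 2 := fun _ _ => trivial

theorem costLE_dart : dart.CostLE 3 := fun _ _ _ _ => trivial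

theorem costLE_originPair : originPair.CostLE 7 :=
  costLE_dart.bind fun x => costLE_dart.bind fun y =>
    show CostLE (ask (.pair x.origin y.origin) fun b =>
      ret (OriginPairSample.mk x.originDeg y.originDeg b)) 1 from fun _ => trivial

end Prog

namespace InputGraph

open Prog

variable {V : Finset ℕ} (G : InputGraph V)

theorem oracle_degree (v : V) : G.oracle (.degree v) = PMF.pure (α := ℕ) (G.deg v) :=
  congrArg PMF.pure (dif_pos v.2)

open scoped Classical in
theorem oracle_pair (u v : V) :
    G.oracle (.pair u v) = PMF.pure (α := Bool) (decide (G.graph.Adj u v)) := by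
  simp only [oracle, SetLike.coe_mem, exists_true_left]
  rfl

theorem eval_degree (v : V) : (degree v).eval G.oracle = PMF.pure (G.deg v) :=
  (PMF.bind_pure _).trans (G.oracle_degree v)

open scoped Classical in
theorem eval_pair (u v : V) : (pair u v).eval G.oracle = PMF.pure (decide (G.graph.Adj u v)) :=
  (PMF.bind_pure _).trans (G.oracle_pair u v)

theorem expect_oracle_randVert (f : ℕ → ℝ≥0∞) :
    expect (α := ℕ) (G.oracle .randVert) f = (V.card : ℝ≥0∞)⁻¹ * ∑ v : V, f v := by
  rw [Finset.sum_coe_sort V f]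
  exact expect_uniformOfFinset V G.nonempty f

open scoped Classical in
theorem expect_oracle_randNbr (v : V) (f : Option ℕ → ℝ≥0∞) :
    expect (α := Option ℕ) (G.oracle (.randNbr v)) f =
      (G.deg v : ℝ≥0∞)⁻¹ * ∑ w ∈ G.graph.neighborFinset v, f (some (w : ℕ)) := by
  have horacle : G.oracle (.randNbr v) = (PMF.uniformOfFinset (G.graph.neighborFinset v)
      (G.neighborFinset_nonempty v)).map fun y => some (y : ℕ) := dif_pos v.2
  rw [horacle, deg, ← G.graph.card_neighborFinset_eq_degree]
  exact (expect_map _ _ _).trans <| (expect_bind _ _ _).trans <|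
    (expect_uniformOfFinset _ _ _).trans <|
    congrArg _ (Finset.sum_congr rfl fun _ _ => expect_pure _ _)

theorem expect_oracle_randEdge (f : V → V → ℝ≥0∞) (F : Sym2 ℕ → ℝ≥0∞)
    (hF : ∀ u v : V, F s((u : ℕ), (v : ℕ)) = f u v + f v u) :
    expect (α := Sym2 ℕ) (G.oracle .randEdge) F = (G.numEdges : ℝ≥0∞)⁻¹ * G.dartSum f := by
  classical
  rw [← G.sum_edgeFinset_eq_dartSum f (fun e => F (e.map ((↑) : V → ℕ))) hF]
  exact (expect_map _ _ _).trans (expect_uniformOfFinset _ _ _)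

theorem expect_vertexDegree (f : ℕ → ℝ≥0) :
    (expect (vertexDegree.eval G.oracle) fun d => (f d : ℝ≥0∞)) =
      (((V.card : ℝ≥0)⁻¹ * ∑ v : V, f (G.deg v) : ℝ≥0) : ℝ≥0∞) := by
  have hrandVert : randVert.eval G.oracle = G.oracle .randVert := PMF.bind_pure _
  have hcard : (V.card : ℝ≥0) ≠ 0 := by simp [G.nonempty.ne_empty]
  rw [vertexDegree, eval_bind, expect_bind, hrandVert, expect_oracle_randVert, ENNReal.coe_mul,
    ENNReal.coe_inv hcard, ENNReal.ofNNReal_finsetSum]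
  simp only [eval_degree, expect_pure, ENNReal.coe_natCast]

theorem expect_dart (f : DartSample → ℝ≥0∞) :
    expect (dart.eval G.oracle) f =
      (2 * G.numEdges : ℝ≥0∞)⁻¹ * G.dartSum fun u v => f ⟨u, G.deg u, G.deg v⟩ := by
  have hrandEdge : randEdge.eval G.oracle = G.oracle .randEdge := PMF.bind_pure _
  let F (a : ℕ × ℕ) : ℝ≥0∞ := expect ((degree a.1).eval G.oracle) fun d₁ =>
    expect ((degree a.2).eval G.oracle) fun d₂ => f ⟨a.1, d₁, d₂⟩
  have hF (u v : V) : F (u, v) = f ⟨u, G.deg u, G.deg v⟩ := by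
    simp only [F, eval_degree, expect_pure]
  have horient (u v : V) : F (Quot.out s((u : ℕ), (v : ℕ))) +
      F (Quot.out s((u : ℕ), (v : ℕ))).swap = F (u, v) + F (v, u) := by
    obtain h | h := Sym2.eq_iff.1 (Quot.out_eq s((u : ℕ), (v : ℕ)))
    · rw [show Quot.out s((u : ℕ), (v : ℕ)) = ((u : ℕ), (v : ℕ)) from Prod.ext h.1 h.2, Prod.swap]
    · rw [show Quot.out s((u : ℕ), (v : ℕ)) = ((v : ℕ), (u : ℕ)) from Prod.ext h.1 h.2, Prod.swap,
        add_comm]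
  calc expect (dart.eval G.oracle) f
      = expect (randEdge.eval G.oracle) fun e => 2⁻¹ * (F (Quot.out e) + F (Quot.out e).swap) := by
        simp only [dart, eval_bind, eval_pure, expect_bind, expect_pure, expect_coin, F, if_true,
          Bool.false_eq_true, if_false]
    _ = 2⁻¹ * ((G.numEdges : ℝ≥0∞)⁻¹ * G.dartSum fun u v => F (u, v)) := by
        rw [expect_const_mul, hrandEdge, G.expect_oracle_randEdge (fun u v => F (u, v)) _ horient]
    _ = _ := by
        rw [← mul_assoc, ← ENNReal.mul_inv (by simp) (by simp)]
        simp only [hF]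

theorem expect_dart_coe (f : DartSample → ℝ≥0) :
    (expect (dart.eval G.oracle) fun x => (f x : ℝ≥0∞)) =
      (((2 * G.numEdges : ℝ≥0)⁻¹ *
        G.dartSum fun u v => f ⟨u, G.deg u, G.deg v⟩ : ℝ≥0) : ℝ≥0∞) := by
  have hm : (2 * G.numEdges : ℝ≥0) ≠ 0 := by simp [G.numEdges_pos.ne']
  rw [expect_dart, ENNReal.coe_mul, ENNReal.coe_inv hm, coe_dartSum]
  push_cast
  rfl

open scoped Classical in
theorem expect_originPair_coe (f : OriginPairSample → ℝ≥0) :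
    (expect (originPair.eval G.oracle) fun x => (f x : ℝ≥0∞)) =
      ((((2 * G.numEdges : ℝ≥0)⁻¹) ^ 2 * ∑ u, ∑ v, (G.deg u : ℝ≥0) * G.deg v *
        f ⟨G.deg u, G.deg v, decide (G.graph.Adj u v)⟩ : ℝ≥0) : ℝ≥0∞) := by
  have hm : (2 * G.numEdges : ℝ≥0) ≠ 0 := by simp [G.numEdges_pos.ne']
  rw [ENNReal.coe_mul, ENNReal.coe_pow, ENNReal.coe_inv hm]
  push_cast
  simp only [originPair, eval_bind, eval_pure, expect_bind, expect_pure, expect_dart, eval_pair,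
    dartSum_fst, nsmul_eq_mul, Finset.mul_sum]
  refine Finset.sum_congr rfl fun u _ => Finset.sum_congr rfl fun v _ => ?_
  ring

theorem one_le_avgDegree : 1 ≤ G.avgDegree := by
  have hn : (0 : ℝ) < V.card := by exact_mod_cast G.nonempty.card_pos
  have h : V.card ≤ 2 * G.numEdges := by
    rw [← sum_deg]
    calc V.card = ∑ _v : V, 1 := by simp
      _ ≤ _ := Finset.sum_le_sum fun v _ => G.deg_pos v
  rw [avgDegree, le_div_iff₀ hn, one_mul]
  exact_mod_cast h

theorem avgDegree_lt_card : G.avgDegree < V.card := by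
  have hn : (0 : ℝ) < V.card := by exact_mod_cast G.nonempty.card_pos
  have h : 2 * G.numEdges < V.card * V.card := by
    classical
    rw [← sum_deg]
    calc ∑ v, G.deg v < ∑ _v : V, V.card :=
          Finset.sum_lt_sum_of_nonempty G.nonempty.attach fun v _ =>
            (G.graph.degree_lt_card_verts v).trans_eq (Fintype.card_coe V)
      _ = V.card * V.card := by simp
  rw [avgDegree, div_lt_iff₀ hn]
  exact_mod_cast h

theorem two_le_card (G : InputGraph V) : 2 ≤ V.card := by
  have : (1 : ℝ) < V.card := G.one_le_avgDegree.trans_lt G.avgDegree_lt_card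
  exact_mod_cast this

theorem two_mul_numEdges : 2 * (G.numEdges : ℝ) = V.card * G.avgDegree := by
  have hn : (0 : ℝ) < V.card := by exact_mod_cast G.nonempty.card_pos
  rw [avgDegree]
  field_simp

/-- The sum of the degrees of the vertices of degree at most `τ`. -/
def lowSum (τ : ℕ) : ℕ := ∑ v, if G.deg v ≤ τ then G.deg v else 0

/-- The number of ordered pairs of adjacent vertices of degree more than `τ`. -/
def highSum (τ : ℕ) : ℕ := G.dartSum fun u v => if τ < G.deg u ∧ τ < G.deg v then 1 else 0

theorem lowSum_eq_dartSum (τ : ℕ) :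
    G.lowSum τ = G.dartSum fun u _ => if G.deg u ≤ τ then 1 else 0 := by
  rw [dartSum_fst, lowSum]
  refine Finset.sum_congr rfl fun v _ => ?_
  split_ifs <;> simp

theorem two_mul_numEdges_le (τ : ℕ) : 2 * G.numEdges ≤ 2 * G.lowSum τ + G.highSum τ := by
  have hall : 2 * G.numEdges = G.dartSum fun _ _ => 1 := by
    rw [← sum_deg, dartSum_fst]
    simp
  rw [two_mul (G.lowSum τ)]
  nth_rewrite 1 [lowSum_eq_dartSum, ← dartSum_swap]
  rw [lowSum_eq_dartSum, hall, highSum]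
  simp only [dartSum, ← Finset.sum_add_distrib]
  refine Finset.sum_le_sum fun u _ => Finset.sum_le_sum fun v _ => ?_
  split_ifs <;> omega

end InputGraph

namespace RatioTest

open Prog

/-- A random dart has an origin of degree `x` with `𝔼 x⁻¹ = d⁻¹`. -/
def edgeTest : RatioTest where
  num := pure 1
  den := (fun x => (x.originDeg : ℝ≥0)⁻¹) <$> dart
  scale := 1

/-- Compares how the vertices of degree at most `τ` are represented in vertex samples and in edge
samples. -/
def lowTest (τ : ℕ) : RatioTest where
  num := (fun d => if d ≤ τ then (d / τ : ℝ≥0) else 0) <$> vertexDegree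
  den := (fun x => if x.originDeg ≤ τ then 1 else 0) <$> dart
  scale := τ

/-- Compares how the edges between vertices of degree more than `τ` are represented among random
darts and among the pairs of origins of random darts. -/
def highTest (n τ : ℕ) : RatioTest where
  num := (fun x => if τ < x.originDeg ∧ τ < x.targetDeg then 1 else 0) <$> dart
  den := (fun x => if τ < x.deg₁ ∧ τ < x.deg₂ ∧ x.adj = true then
    (τ ^ 2 / (x.deg₁ * x.deg₂) : ℝ≥0) else 0) <$> originPair
  scale := τ ^ 2 / n

/-- All tests with a threshold `2 ^ i`, `i ≤ L`. -/
def tests (n L : ℕ) : List RatioTest :=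
  edgeTest :: (List.range (L + 1)).flatMap fun i => [lowTest (2 ^ i), highTest n (2 ^ i)]

theorem mem_tests {n L : ℕ} {E : RatioTest} : E ∈ tests n L ↔
    E = edgeTest ∨ ∃ i < L + 1, E = lowTest (2 ^ i) ∨ E = highTest n (2 ^ i) := by
  simp [tests]

theorem length_tests (n L : ℕ) : (tests n L).length = 2 * L + 3 := by
  simp only [tests, List.length_cons, List.length_flatMap, List.length_nil, List.map_const',
    List.length_range, List.sum_replicate, smul_eq_mul]
  ring

theorem costLE_prog_of_mem_tests {n L : ℕ} {E : RatioTest} (hE : E ∈ tests n L) (N : ℕ) (T : ℝ) :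
    (E.prog N T).CostLE (N * 10) := by
  obtain rfl | ⟨i, -, rfl | rfl⟩ := mem_tests.1 hE
  · exact (costLE_prog (costLE_pure _ 0) (costLE_dart.map _) N T).mono (by omega)
  · exact (costLE_prog (costLE_vertexDegree.map _) (costLE_dart.map _) N T).mono (by omega)
  · exact costLE_prog (E := highTest n (2 ^ i)) (costLE_dart.map _) (costLE_originPair.map _) N T

end RatioTest

namespace InputGraph

open Prog RatioTest

variable {V : Finset ℕ} (G : InputGraph V)

theorem underdispersed_dart {f : DartSample → ℝ≥0} (hf : ∀ x, f x ≤ 1) {S : ℝ≥0}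
    (hS : G.dartSum (fun u v => f ⟨u, G.deg u, G.deg v⟩) = S) :
    Underdispersed ((f <$> dart).eval G.oracle) ((2 * G.numEdges : ℝ≥0)⁻¹ * S) := by
  rw [eval_map, ← hS]
  exact .map_of_le_one hf (G.expect_dart_coe f)

theorem estimates_edgeTest :
    edgeTest.Estimates G.oracle 1 ((2 * G.numEdges : ℝ≥0)⁻¹ * V.card) G.avgDegree where
  num := .pure 1
  den := by
    refine G.underdispersed_dart (fun x => Nat.cast_inv_le_one x.originDeg) ?_
    rw [G.dartSum_fst fun u => (G.deg u : ℝ≥0)⁻¹, Finset.sum_congr rfl fun u _ => by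
      rw [nsmul_eq_mul, mul_inv_cancel₀ (by simp [(G.deg_pos u).ne'])]]
    simp
  scale_nonneg := zero_le_one
  scale_mul _ _ := by
    rw [edgeTest, avgDegree]
    push_cast
    field_simp

theorem estimates_lowTest (τ : ℕ) :
    (lowTest τ).Estimates G.oracle ((V.card : ℝ≥0)⁻¹ * (G.lowSum τ / τ))
      ((2 * G.numEdges : ℝ≥0)⁻¹ * G.lowSum τ) G.avgDegree where
  num := by
    rw [lowTest, eval_map]
    refine .map_of_le_one (fun d => ?_) ((G.expect_vertexDegree _).trans ?_)
    · split_ifs with h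
      · exact div_le_one_of_le₀ (by exact_mod_cast h) zero_le
      · exact zero_le
    · simp only [lowSum, Nat.cast_sum, Finset.sum_div, Nat.cast_ite, Nat.cast_zero, ite_div,
        zero_div]
  den := by
    refine G.underdispersed_dart (fun x => ?_) ?_
    · split_ifs <;> simp
    · rw [lowSum_eq_dartSum]
      simp only [dartSum]
      push_cast
      rfl
  scale_nonneg := Nat.cast_nonneg τ
  scale_mul hμ hν := by
    have hτ : (τ : ℝ) ≠ 0 := by
      rintro h
      simp_all
    have hS : (G.lowSum τ : ℝ) ≠ 0 := by exact_mod_cast right_ne_zero_of_mul hν.ne'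
    rw [lowTest, avgDegree]
    push_cast
    field_simp

theorem estimates_highTest (τ : ℕ) :
    (highTest V.card τ).Estimates G.oracle ((2 * G.numEdges : ℝ≥0)⁻¹ * G.highSum τ)
      ((2 * G.numEdges : ℝ≥0)⁻¹ ^ 2 * (τ ^ 2 * G.highSum τ)) G.avgDegree where
  num := by
    refine G.underdispersed_dart (fun x => ?_) ?_
    · split_ifs <;> simp
    · simp only [highSum, dartSum]
      push_cast
      rfl
  den := by
    classical
    rw [highTest, eval_map]
    refine .map_of_le_one (fun x => ?_) ((G.expect_originPair_coe _).trans ?_)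
    · split_ifs with h
      · refine div_le_one_of_le₀ ?_ zero_le
        rw [sq]
        exact mul_le_mul' (by exact_mod_cast h.1.le) (by exact_mod_cast h.2.1.le)
      · exact zero_le
    · congr 2
      simp only [highSum, dartSum]
      push_cast
      simp only [Finset.mul_sum]
      refine Finset.sum_congr rfl fun u _ => Finset.sum_congr rfl fun v _ => ?_
      have hu : (G.deg u : ℝ≥0) ≠ 0 := by simp [(G.deg_pos u).ne']
      have hv : (G.deg v : ℝ≥0) ≠ 0 := by simp [(G.deg_pos v).ne']
      by_cases huv : G.graph.Adj u v <;> by_cases hu' : τ < G.deg u <;>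
        by_cases hv' : τ < G.deg v <;> simp [huv, hu', hv']
      field_simp
  scale_nonneg := by rw [highTest]; positivity
  scale_mul hμ hν := by
    have hτ : (τ : ℝ) ≠ 0 := by
      rintro h
      simp_all
    have hS : (G.highSum τ : ℝ) ≠ 0 := by exact_mod_cast right_ne_zero_of_mul hμ.ne'
    have hm : (G.numEdges : ℝ) ≠ 0 := by exact_mod_cast G.numEdges_pos.ne'
    rw [highTest, avgDegree]
    push_cast
    field_simp

theorem estimates_of_mem_tests {L : ℕ} {E : RatioTest} (hE : E ∈ tests V.card L) :
    ∃ μ ν, E.Estimates G.oracle μ ν G.avgDegree := by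
  obtain rfl | ⟨i, -, rfl | rfl⟩ := mem_tests.1 hE
  · exact ⟨_, _, G.estimates_edgeTest⟩
  · exact ⟨_, _, G.estimates_lowTest _⟩
  · exact ⟨_, _, G.estimates_highTest _⟩

end InputGraph

theorem exists_two_pow_threshold {n d B : ℝ} (hB : 0 < B) (hd : 0 < d) (hBnd : B ≤ n * d)
    (hn : n ≤ B ^ 3 * d) :
    ∃ i : ℕ, n * d / B ≤ (2 ^ i) ^ 2 ∧ (2 ^ i) ^ 2 ≤ 4 * (n * d / B) ∧ 2 ^ i ≤ 2 * B * d := by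
  obtain ⟨a, ha₁, ha₂⟩ :=
    exists_nat_pow_near ((one_le_div hB).2 hBnd) (show (1 : ℝ) < 4 by norm_num)
  have hpow : ((2 : ℝ) ^ (a + 1)) ^ 2 = 4 ^ (a + 1) := by rw [pow_right_comm]; norm_num
  have hle : ((2 : ℝ) ^ (a + 1)) ^ 2 ≤ 4 * (n * d / B) := by rw [hpow, pow_succ']; gcongr
  refine ⟨a + 1, hpow ▸ ha₂.le, hle, le_of_sq_le_sq ?_ (by positivity)⟩
  calc ((2 : ℝ) ^ (a + 1)) ^ 2 ≤ 4 * (n * d / B) := hle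
    _ ≤ 4 * (B ^ 3 * d * d / B) := by gcongr
    _ = (2 * B * d) ^ 2 := by field_simp; ring

namespace InputGraph

open RatioTest

variable {V : Finset ℕ} (G : InputGraph V)

theorem one_div_le_means_lowTest {B : ℝ} {τ : ℕ} (hB : 1 ≤ B) (hτ : 0 < τ)
    (hτB : τ ≤ 2 * B * G.avgDegree) (hlow : (G.numEdges : ℝ) / 2 ≤ G.lowSum τ) :
    1 / (8 * B) ≤ (V.card : ℝ)⁻¹ * (G.lowSum τ / τ) ∧
      1 / (8 * B) ≤ (2 * (G.numEdges : ℝ))⁻¹ * G.lowSum τ := by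
  have hm : (0 : ℝ) < G.numEdges := by exact_mod_cast G.numEdges_pos
  have hn : (0 : ℝ) < V.card := by exact_mod_cast G.nonempty.card_pos
  have hd : 0 < G.avgDegree := zero_lt_one.trans_le G.one_le_avgDegree
  have hnd := G.two_mul_numEdges
  constructor
  · calc 1 / (8 * B) = (V.card : ℝ)⁻¹ * (V.card * G.avgDegree / 4 / (2 * B * G.avgDegree)) := by
          field_simp; norm_num
      _ ≤ (V.card : ℝ)⁻¹ * (G.lowSum τ / τ) := by gcongr; linarith
  · calc 1 / (8 * B) ≤ 1 / 4 := by gcongr; linarith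
      _ = (2 * (G.numEdges : ℝ))⁻¹ * (G.numEdges / 2) := by field_simp; norm_num
      _ ≤ _ := by gcongr

theorem one_div_le_means_highTest {B : ℝ} {τ : ℕ} (hB : 1 ≤ B)
    (hτB : V.card * G.avgDegree / B ≤ (τ : ℝ) ^ 2) (hhigh : (G.numEdges : ℝ) ≤ G.highSum τ) :
    1 / (8 * B) ≤ (2 * (G.numEdges : ℝ))⁻¹ * G.highSum τ ∧
      1 / (8 * B) ≤ (2 * (G.numEdges : ℝ))⁻¹ ^ 2 * (τ ^ 2 * G.highSum τ) := by
  have hm : (0 : ℝ) < G.numEdges := by exact_mod_cast G.numEdges_pos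
  rw [← G.two_mul_numEdges] at hτB
  constructor
  · calc 1 / (8 * B) ≤ 1 / 2 := by gcongr; linarith
      _ = (2 * (G.numEdges : ℝ))⁻¹ * G.numEdges := by field_simp
      _ ≤ _ := by gcongr
  · calc 1 / (8 * B) ≤ 1 / (2 * B) := by gcongr; norm_num
      _ = (2 * (G.numEdges : ℝ))⁻¹ ^ 2 * (2 * G.numEdges / B * G.numEdges) := by field_simp
      _ ≤ _ := by gcongr

theorem exists_mem_tests {B : ℝ} {L : ℕ} (hL : V.card < 2 ^ L) (hB : 1 ≤ B)
    (hBd : B ≤ 2 * G.avgDegree) (hcase : G.avgDegree ≤ B ∨ V.card ≤ B ^ 3 * G.avgDegree) :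
    ∃ E ∈ tests V.card L, ∃ μ ν : ℝ≥0, E.Estimates G.oracle μ ν G.avgDegree ∧
      1 / (8 * B) ≤ μ ∧ 1 / (8 * B) ≤ ν := by
  have hd1 := G.one_le_avgDegree
  have hdn := G.avgDegree_lt_card
  have hn2 : (2 : ℝ) ≤ V.card := by exact_mod_cast G.two_le_card
  obtain hdB | hnB := hcase
  · refine ⟨edgeTest, mem_tests.2 (.inl rfl), _, _, G.estimates_edgeTest, ?_, ?_⟩
    · exact (div_le_one (by positivity)).2 (by linarith)
    · push_cast
      rw [G.two_mul_numEdges, mul_inv, mul_right_comm, inv_mul_cancel₀ (by positivity), one_mul,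
        ← one_div]
      gcongr
      linarith
  · obtain ⟨i, hi₁, hi₂, hi₃⟩ := exists_two_pow_threshold (by positivity) (by positivity)
      (by nlinarith : B ≤ V.card * G.avgDegree) hnB
    have hiL : i < L + 1 := by
      have hL' : (V.card : ℝ) < 2 ^ L := by exact_mod_cast hL
      have : ((2 : ℝ) ^ i) ^ 2 < (2 ^ (L + 1)) ^ 2 := calc
        ((2 : ℝ) ^ i) ^ 2 ≤ 4 * (V.card * G.avgDegree / 1) := hi₂.trans (by gcongr)
        _ < 4 * (2 ^ L * 2 ^ L / 1) := by gcongr; exact hdn.trans hL'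
        _ = (2 ^ (L + 1)) ^ 2 := by ring
      exact (pow_lt_pow_iff_right₀ one_lt_two).1 (lt_of_pow_lt_pow_left₀ 2 (by positivity) this)
    have hsum : 2 * (G.numEdges : ℝ) ≤ 2 * G.lowSum (2 ^ i) + G.highSum (2 ^ i) := by
      exact_mod_cast G.two_mul_numEdges_le (2 ^ i)
    obtain hhigh | hlow := le_or_gt (G.numEdges : ℝ) (G.highSum (2 ^ i))
    · have := G.one_div_le_means_highTest (τ := 2 ^ i) hB (by exact_mod_cast hi₁) hhigh
      exact ⟨_, mem_tests.2 (.inr ⟨i, hiL, .inr rfl⟩), _, _, G.estimates_highTest _,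
        by exact_mod_cast this.1, by exact_mod_cast this.2⟩
    · have := G.one_div_le_means_lowTest (τ := 2 ^ i) hB (by positivity) (by exact_mod_cast hi₃)
        (by linarith)
      exact ⟨_, mem_tests.2 (.inr ⟨i, hiL, .inl rfl⟩), _, _, G.estimates_lowTest _,
        by exact_mod_cast this.1, by exact_mod_cast this.2⟩

end InputGraph

open RatioTest

/-- The number of sample sizes, and of degree thresholds, tried on a graph with `n` vertices. -/
def numLevels (n : ℕ) : ℕ := Nat.log 2 n + 1

/-- The sample size in phase `j`, in which means down to `1 / (8 * 2 ^ j)` are detected. -/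
def sampleSize (T : ℝ) (j : ℕ) : ℕ := ⌈16 * T * 2 ^ j⌉₊

/-- The first `m` phases of the algorithm. Phase `j` performs every test with `sampleSize T j`
samples. -/
def phases (n m : ℕ) : List (ℕ × RatioTest) := List.range m ×ˢ tests n (numLevels n)

/-- The sample sum that both sides of a ratio test have to reach. The factor is so large that all
tests together fail with probability less than `1 / 100`. -/
def testThreshold (n : ℕ) (ε : ℝ) : ℝ :=
  6401 * ((numLevels n + 1) * (2 * numLevels n + 3)) / ε ^ 2

/-- The test of a phase, as a program. -/
def phaseTrial (T : ℝ) (x : ℕ × RatioTest) : Prog (Option ℝ) := x.2.prog (sampleSize T x.1) T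

/-- The algorithm of the upper bound: it doubles the sample size until some test is conclusive. -/
def avgDegreeProg (n : ℕ) (T : ℝ) : Prog ℝ :=
  Prog.firstSome (phaseTrial T) (phases n (numLevels n + 1))

theorem lt_two_pow_numLevels (n : ℕ) : n < 2 ^ numLevels n :=
  Nat.lt_pow_succ_log_self one_lt_two n

theorem numLevels_le {n : ℕ} (hn : 2 ≤ n) : (numLevels n : ℝ) ≤ 3 * Real.log n := by
  have hpow : ((2 ^ Nat.log 2 n : ℕ) : ℝ) ≤ n := by
    exact_mod_cast Nat.pow_log_le_self 2 (by omega)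
  have hlog := Real.log_le_log (by positivity) hpow
  rw [Nat.cast_pow, Real.log_pow, Nat.cast_ofNat] at hlog
  have h2n : Real.log 2 ≤ Real.log n := Real.log_le_log two_pos (by exact_mod_cast hn)
  have : (0 : ℝ) ≤ Nat.log 2 n := Nat.cast_nonneg _
  rw [numLevels]
  push_cast
  nlinarith [Real.log_two_gt_d9]

theorem one_le_testThreshold (n : ℕ) {ε : ℝ} (hε : 0 < ε) (hε1 : ε < 1) :
    1 ≤ testThreshold n ε := by
  have : (0 : ℝ) ≤ numLevels n := Nat.cast_nonneg _
  rw [testThreshold, le_div_iff₀ (by positivity)]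
  nlinarith

theorem length_phases (n m : ℕ) : (phases n m).length = m * (2 * numLevels n + 3) := by
  rw [phases, List.length_product, List.length_range, length_tests]

theorem phases_prefix (n : ℕ) {m m' : ℕ} (h : m ≤ m') : phases n m <+: phases n m' := by
  obtain ⟨k, rfl⟩ := Nat.exists_eq_add_of_le h
  rw [phases, phases, SProd.sprod, List.instSProd, List.range_add]
  simp only [List.product, List.flatMap_append, List.prefix_append]

theorem costLE_phaseTrial {T : ℝ} {n m : ℕ} {x : ℕ × RatioTest} (hx : x ∈ phases n m) :
    (phaseTrial T x).CostLE (sampleSize T x.1 * 10) :=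
  costLE_prog_of_mem_tests (List.mem_product.1 hx).2 _ _

theorem sampleSize_le {T : ℝ} (hT : 1 ≤ T) (j : ℕ) : (sampleSize T j : ℝ) ≤ 17 * T * 2 ^ j := by
  have h2 : (1 : ℝ) ≤ 2 ^ j := one_le_pow₀ one_le_two
  have := (Nat.ceil_lt_add_one (show 0 ≤ 16 * T * 2 ^ j by positivity)).le
  rw [sampleSize]
  nlinarith

theorem sum_map_product_fst {α β : Type*} (f : α → ℕ) (l : List α) (l' : List β) :
    ((l ×ˢ l').map fun x => f x.1).sum = l'.length * (l.map f).sum := by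
  induction l with
  | nil => simp
  | cons a l ih => simp [List.product_cons, Function.comp_def, ih, mul_add]

theorem sum_cost_phases_le {T : ℝ} (hT : 1 ≤ T) (n m : ℕ) :
    (((phases n m).map fun x => sampleSize T x.1 * 10).sum : ℝ) ≤
      (2 * numLevels n + 3) * (170 * T * 2 ^ m) := by
  have hsum : ((phases n m).map fun x => sampleSize T x.1 * 10).sum =
      (2 * numLevels n + 3) * ∑ j ∈ Finset.range m, sampleSize T j * 10 := by
    rw [phases, sum_map_product_fst fun j => sampleSize T j * 10, length_tests]
    rfl
  have hgeom : ∑ j ∈ Finset.range m, (2 : ℝ) ^ j ≤ 2 ^ m := by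
    rw [geom_sum_eq (by norm_num)]
    norm_num
  rw [hsum]
  push_cast
  gcongr
  calc ∑ j ∈ Finset.range m, (sampleSize T j : ℝ) * 10
      ≤ ∑ j ∈ Finset.range m, 17 * T * 2 ^ j * 10 := by
        gcongr with j
        exact sampleSize_le hT j
    _ = 170 * T * ∑ j ∈ Finset.range m, (2 : ℝ) ^ j := by
        rw [Finset.mul_sum]
        exact Finset.sum_congr rfl fun j _ => by ring
    _ ≤ 170 * T * 2 ^ m := by gcongr

theorem length_phases_mul_le {n m : ℕ} (hm : m ≤ numLevels n + 1) {ε : ℝ} (hε : 0 < ε) :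
    (phases n m).length * ENNReal.ofReal (4 / ((ε / 4) ^ 2 * testThreshold n ε)) ≤
      ENNReal.ofReal (64 / 6401) := by
  rw [← ENNReal.ofReal_natCast, ← ENNReal.ofReal_mul (by positivity), length_phases]
  have hm' : (m : ℝ) ≤ numLevels n + 1 := by exact_mod_cast hm
  have hT : 0 ≤ testThreshold n ε := by rw [testThreshold]; positivity
  refine ENNReal.ofReal_le_ofReal ?_
  push_cast
  calc (m : ℝ) * (2 * numLevels n + 3) * (4 / ((ε / 4) ^ 2 * testThreshold n ε))
      ≤ (numLevels n + 1) * (2 * numLevels n + 3) *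
        (4 / ((ε / 4) ^ 2 * testThreshold n ε)) := by gcongr
    _ = 64 / 6401 := by
        rw [testThreshold]
        field_simp
        norm_num

theorem sum_cost_phases_le_budget {n : ℕ} (hn : 2 ≤ n) {ε : ℝ} (hε : 0 < ε) (hε1 : ε < 1) {j : ℕ}
    {M : ℝ} (hjM : 2 ^ j ≤ 2 * M) :
    ((phases n (j + 1)).map fun x => sampleSize (testThreshold n ε) x.1 * 10).sum ≤
      ⌊6000000000 * Real.log n ^ 3 * (ε ^ 2)⁻¹ * M⌋₊ := by
  have hl := numLevels_le hn
  have hl1 : (1 : ℝ) ≤ numLevels n := by exact_mod_cast Nat.le_add_left 1 (Nat.log 2 n)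
  have hjM' : (2 : ℝ) ^ (j + 1) ≤ 4 * M := by rw [pow_succ]; linarith
  have hM : 0 ≤ M := by linarith [pow_pos (two_pos (α := ℝ)) j]
  have : 0 ≤ Real.log n := Real.log_natCast_nonneg n
  set l : ℝ := (numLevels n : ℝ) with hl_def
  refine Nat.le_floor ((sum_cost_phases_le (one_le_testThreshold n hε hε1) n _).trans ?_)
  calc (2 * l + 3) * (170 * testThreshold n ε * 2 ^ (j + 1))
      ≤ (5 * l) * (170 * (6401 * ((2 * l) * (5 * l)) / ε ^ 2) * (4 * M)) := by
        rw [testThreshold, ← hl_def]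
        gcongr <;> linarith
    _ = 217634000 * l ^ 3 * (ε ^ 2)⁻¹ * M := by rw [div_eq_mul_inv]; ring
    _ ≤ 217634000 * (3 * Real.log n) ^ 3 * (ε ^ 2)⁻¹ * M := by gcongr
    _ = 5876118000 * Real.log n ^ 3 * (ε ^ 2)⁻¹ * M := by ring
    _ ≤ 6000000000 * Real.log n ^ 3 * (ε ^ 2)⁻¹ * M := by gcongr; norm_num

theorem le_pow_three_of_rpow_third_le {x y : ℝ} (hx : 0 ≤ x) (h : x ^ (1 / 3 : ℝ) ≤ y) :
    x ≤ y ^ 3 :=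
  calc x = (x ^ (1 / 3 : ℝ)) ^ 3 := by
        rw [← Real.rpow_natCast, ← Real.rpow_mul hx]; norm_num
    _ ≤ _ := by gcongr

namespace InputGraph

variable {V : Finset ℕ} (G : InputGraph V)

theorem approxProb_eq (A : QueryAlgorithm) (b : ℕ) (c : ℝ) :
    A.approxProb G b c = (A.run G.oracle b A.init).toOuterMeasure
      (some '' Set.Icc (G.avgDegree / c) (c * G.avgDegree)) := by
  rw [QueryAlgorithm.approxProb]
  congr 1
  ext o
  simp [and_comm, eq_comm]

theorem approxProb_mono (p : Prog ℝ) {b b' : ℕ} (h : b ≤ b') (c : ℝ) :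
    p.toAlgorithm.approxProb G b c ≤ p.toAlgorithm.approxProb G b' c := by
  rw [approxProb_eq, approxProb_eq]
  exact QueryAlgorithm.toOuterMeasure_run_mono _ _ _ h _

theorem one_le_approxProb_add {ε : ℝ} (hε : 0 < ε) (hε1 : ε < 1) {T : ℝ} (hT : 0 < T)
    {j : ℕ} (hj : j < numLevels V.card + 1) (hjd : 2 ^ j ≤ 2 * G.avgDegree)
    (hcase : G.avgDegree ≤ 2 ^ j ∨ V.card ≤ (2 ^ j) ^ 3 * G.avgDegree) :
    1 ≤ (avgDegreeProg V.card T).toAlgorithm.approxProb G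
        ((phases V.card (j + 1)).map fun x => sampleSize T x.1 * 10).sum (1 + ε) +
      (phases V.card (j + 1)).length * ENNReal.ofReal (4 / ((ε / 4) ^ 2 * T)) := by
  obtain ⟨E, hE, μ, ν, hest, hμ, hν⟩ :=
    G.exists_mem_tests (lt_two_pow_numLevels _) (one_le_pow₀ one_le_two) hjd hcase
  have hsize : ∀ {a : ℝ≥0}, 1 / (8 * 2 ^ j) ≤ (a : ℝ) → 2 * T ≤ sampleSize T j * a := fun ha =>
    calc 2 * T = 16 * T * 2 ^ j * (1 / (8 * 2 ^ j)) := by field_simp; norm_num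
      _ ≤ sampleSize T j * _ := by gcongr; exact Nat.le_ceil _
  have hmem : (j, E) ∈ phases V.card (j + 1) :=
    List.mem_product.2 ⟨List.self_mem_range_succ, hE⟩
  obtain ⟨rest, hrest⟩ := phases_prefix V.card (Nat.add_one_le_iff.2 hj)
  have hbad : ∀ x ∈ phases V.card (j + 1), ((phaseTrial T x).eval G.oracle).toOuterMeasure
      (some '' (Set.Icc (G.avgDegree / (1 + ε)) ((1 + ε) * G.avgDegree))ᶜ) ≤
        ENNReal.ofReal (4 / ((ε / 4) ^ 2 * T)) := fun x hx => by
    obtain ⟨μ, ν, h⟩ := G.estimates_of_mem_tests (List.mem_product.1 hx).2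
    exact h.toOuterMeasure_bad_le hε hε1 hT _
  have hrun := Prog.one_le_toOuterMeasure_run_firstSome (O := G.oracle) (avgDegreeProg V.card T)
    (trial := phaseTrial T) (i₀ := (j, E))
    (hest.toOuterMeasure_compl_good_le hε hε1 hT (hsize hμ) (hsize hν)) rest
    hmem (fun x hx => costLE_phaseTrial hx) hbad
  rw [hrest] at hrun
  rw [approxProb_eq]
  exact hrun

theorem exists_conclusive_phase :
    ∃ j < numLevels V.card + 1,
      (2 : ℝ) ^ j ≤ 2 * min G.avgDegree ((V.card / G.avgDegree) ^ (1 / 3 : ℝ)) ∧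
      (G.avgDegree ≤ 2 ^ j ∨ V.card ≤ (2 ^ j) ^ 3 * G.avgDegree) := by
  have hd : 0 < G.avgDegree := zero_lt_one.trans_le G.one_le_avgDegree
  set M := min G.avgDegree ((V.card / G.avgDegree) ^ (1 / 3 : ℝ)) with hM
  have hM1 : 1 ≤ M := le_min G.one_le_avgDegree <|
    Real.one_le_rpow ((one_le_div hd).2 G.avgDegree_lt_card.le) (by norm_num)
  obtain ⟨a, ha, haM⟩ := exists_nat_pow_near hM1 one_lt_two
  have hal : (2 : ℝ) ^ a < 2 ^ numLevels V.card := calc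
    (2 : ℝ) ^ a ≤ G.avgDegree := ha.trans (min_le_left _ _)
    _ < V.card := G.avgDegree_lt_card
    _ < 2 ^ numLevels V.card := by exact_mod_cast lt_two_pow_numLevels _
  refine ⟨a + 1, by simpa using (pow_lt_pow_iff_right₀ one_lt_two).1 hal,
    by rw [pow_succ']; gcongr, (min_lt_iff.1 haM).imp le_of_lt fun h => ?_⟩
  rw [← div_le_iff₀ hd]
  exact le_pow_three_of_rpow_third_le (by positivity) h.le

theorem lt_approxProb_avgDegreeProg {ε : ℝ} (hε : 0 < ε) (hε1 : ε < 1) :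
    99 / 100 < (avgDegreeProg V.card (testThreshold V.card ε)).toAlgorithm.approxProb G
      ⌊6000000000 * Real.log V.card ^ 3 * (ε ^ 2)⁻¹ *
        min G.avgDegree ((V.card / G.avgDegree) ^ (1 / 3 : ℝ))⌋₊ (1 + ε) := by
  obtain ⟨j, hj, hjM, hcase⟩ := G.exists_conclusive_phase
  have hjd : (2 : ℝ) ^ j ≤ 2 * G.avgDegree := hjM.trans (by gcongr; exact min_le_left _ _)
  refine lt_of_lt_of_le ?_
    (G.approxProb_mono _ (sum_cost_phases_le_budget G.two_le_card hε hε1 hjM) _)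
  have hT := zero_lt_one.trans_le (one_le_testThreshold V.card hε hε1)
  have h := (G.one_le_approxProb_add hε hε1 hT hj hjd hcase).trans
    (add_le_add_right (length_phases_mul_le hj hε) _)
  refine lt_of_lt_of_le ?_ (tsub_le_iff_right.2 h)
  rw [← ENNReal.ofReal_one, ← ENNReal.ofReal_sub _ (by norm_num),
    show (99 / 100 : ℝ≥0∞) = ENNReal.ofReal (99 / 100) by
      rw [ENNReal.ofReal_div_of_pos (by norm_num)]; norm_num]
  exact (ENNReal.ofReal_lt_ofReal_iff (by norm_num)).2 (by norm_num)

end InputGraph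

theorem min_le_rpow_quarter {d n : ℝ} (hd : 1 ≤ d) (hn : 1 ≤ n) :
    min d ((n / d) ^ (1 / 3 : ℝ)) ≤ n ^ (1 / 4 : ℝ) := by
  have hn₀ : 0 < n := by linarith
  obtain h | h := le_or_gt d (n ^ (1 / 4 : ℝ))
  · exact (min_le_left _ _).trans h
  · have hnd : n / d ≤ n ^ (3 / 4 : ℝ) := by
      rw [div_le_iff₀ (by linarith)]
      calc n = n ^ (3 / 4 : ℝ) * n ^ (1 / 4 : ℝ) := by rw [← Real.rpow_add hn₀]; norm_num
        _ ≤ _ := by gcongr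
    calc min d ((n / d) ^ (1 / 3 : ℝ)) ≤ (n / d) ^ (1 / 3 : ℝ) := min_le_right _ _
      _ ≤ (n ^ (3 / 4 : ℝ)) ^ (1 / 3 : ℝ) := by gcongr
      _ = n ^ (1 / 4 : ℝ) := by rw [← Real.rpow_mul hn₀.le]; norm_num

theorem exists_avgDegree_algorithm :
    ∃ (A : ℕ → ℝ → QueryAlgorithm) (C : ℝ) (k : ℕ), 0 < C ∧
      ∀ (n : ℕ) (ε : ℝ), 0 < ε → ε < 1 →
        ∀ (V : Finset ℕ), V.card = n → ∀ G : InputGraph V,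
          99 / 100 < (A n ε).approxProb G
            ⌊C * Real.log n ^ k * (ε ^ 2)⁻¹ *
              min G.avgDegree ((n / G.avgDegree) ^ (1 / 3 : ℝ))⌋₊ (1 + ε) ∧
          99 / 100 < (A n ε).approxProb G
            ⌊C * Real.log n ^ k * (ε ^ 2)⁻¹ * (n : ℝ) ^ (1 / 4 : ℝ)⌋₊ (1 + ε) := by
  refine ⟨fun n ε => (avgDegreeProg n (testThreshold n ε)).toAlgorithm, 6000000000, 3,
    by norm_num, ?_⟩
  rintro n ε hε hε1 V rfl G
  have h := G.lt_approxProb_avgDegreeProg hε hε1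
  refine ⟨h, h.trans_le (G.approxProb_mono _ (Nat.floor_mono ?_) _)⟩
  have : 0 ≤ Real.log V.card := Real.log_natCast_nonneg _
  gcongr
  exact min_le_rpow_quarter G.one_le_avgDegree (by exact_mod_cast G.nonempty.card_pos)

section Labelings

variable {α L : Type*} [Fintype α] [DecidableEq L]

/-- Every label `a` is used exactly `size a` times. -/
def HasClassSizes (size : L → ℕ) (lam : α → L) : Prop :=
  ∀ a, (Finset.univ.filter fun v => lam v = a).card = size a

variable [Fintype L] (size : L → ℕ)

theorem exists_hasClassSizes (h : ∑ a, size a = Fintype.card α) :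
    ∃ lam : α → L, HasClassSizes size lam := by
  let e : α ≃ Σ a : L, Fin (size a) := Fintype.equivOfCardEq (by simp [h])
  refine ⟨fun v => (e v).1, fun a => ?_⟩
  calc (Finset.univ.filter fun v => (e v).1 = a).card
      = (Finset.univ.filter fun x : Σ a : L, Fin (size a) => x.1 = a).card :=
        Finset.card_equiv e (by simp)
    _ = (Finset.univ.map (Function.Embedding.sigmaMk (β := fun a => Fin (size a)) a)).card := by
        congr 1
        ext ⟨b, i⟩
        simp only [Finset.mem_filter, Finset.mem_univ, true_and, Finset.mem_map,
          Function.Embedding.sigmaMk_apply]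
        constructor
        · rintro rfl
          exact ⟨i, rfl⟩
        · rintro ⟨j, hj⟩
          exact (congrArg Sigma.fst hj).symm
    _ = size a := by simp

variable [DecidableEq α]

open scoped Classical in
/-- The labelings with prescribed class sizes that extend a partial labeling on `D`. -/
def labelings (D : Finset α) (ℓ : α → L) : Finset (α → L) :=
  {lam | HasClassSizes size lam ∧ ∀ u ∈ D, lam u = ℓ u}

theorem mem_labelings {D : Finset α} {ℓ lam : α → L} :
    lam ∈ labelings size D ℓ ↔ HasClassSizes size lam ∧ ∀ u ∈ D, lam u = ℓ u := by
  simp [labelings]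

theorem labelings_congr {D : Finset α} {ℓ ℓ' : α → L} (h : ∀ u ∈ D, ℓ u = ℓ' u) :
    labelings size D ℓ = labelings size D ℓ' := by
  ext lam
  simp only [mem_labelings]
  exact and_congr_right fun _ => forall₂_congr fun u hu => by rw [h u hu]

theorem filter_labelings {D : Finset α} {y : α} (hy : y ∉ D) (ℓ : α → L) (a : L) :
    (labelings size D ℓ).filter (fun lam => lam y = a) =
      labelings size (insert y D) (Function.update ℓ y a) := by
  have hupdate (lam : α → L) : (∀ u ∈ D, lam u = Function.update ℓ y a u) ↔ ∀ u ∈ D, lam u = ℓ u :=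
    forall₂_congr fun u hu => by rw [Function.update_of_ne (ne_of_mem_of_not_mem hu hy)]
  ext lam
  simp only [Finset.mem_filter, mem_labelings, Finset.forall_mem_insert, Function.update_self,
    hupdate]
  tauto

theorem comp_swap_mem_labelings {D : Finset α} {y z : α} (hy : y ∉ D) (hz : z ∉ D) {ℓ lam : α → L}
    (hlam : lam ∈ labelings size D ℓ) : lam ∘ Equiv.swap y z ∈ labelings size D ℓ := by
  simp only [mem_labelings, Function.comp_apply] at hlam ⊢
  refine ⟨fun b => ?_, fun u hu => ?_⟩
  · rw [← hlam.1 b]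
    exact Finset.card_equiv (Equiv.swap y z) (by simp)
  · rw [Equiv.swap_apply_of_ne_of_ne (ne_of_mem_of_not_mem hu hy) (ne_of_mem_of_not_mem hu hz),
      hlam.2 u hu]

theorem card_filter_labelings_eq {D : Finset α} {y z : α} (hy : y ∉ D) (hz : z ∉ D)
    (ℓ : α → L) (a : L) :
    ((labelings size D ℓ).filter fun lam => lam y = a).card =
      ((labelings size D ℓ).filter fun lam => lam z = a).card := by
  refine Finset.card_nbij' (fun lam => lam ∘ Equiv.swap y z) (fun lam => lam ∘ Equiv.swap y z)
    (fun lam hlam => ?_) (fun lam hlam => ?_) (fun lam _ => ?_) (fun lam _ => ?_)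
  · rw [Finset.mem_coe, Finset.mem_filter] at hlam ⊢
    exact ⟨comp_swap_mem_labelings size hy hz hlam.1, by simp [hlam.2]⟩
  · rw [Finset.mem_coe, Finset.mem_filter] at hlam ⊢
    exact ⟨comp_swap_mem_labelings size hy hz hlam.1, by simp [hlam.2]⟩
  · funext v
    simp
  · funext v
    simp

theorem card_labelings_insert {D : Finset α} {y : α} (hy : y ∉ D) (ℓ : α → L) (a : L) :
    (labelings size (insert y D) (Function.update ℓ y a)).card * (Fintype.card α - D.card) =
      (size a - (D.filter fun u => ℓ u = a).card) * (labelings size D ℓ).card := by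
  have hunlabeled : ∀ lam ∈ labelings size D ℓ,
      (∑ z ∈ Dᶜ, if lam z = a then 1 else 0) = size a - (D.filter fun u => ℓ u = a).card := by
    intro lam hlam
    rw [mem_labelings] at hlam
    have hclass := hlam.1 a
    rw [Finset.card_filter, ← Finset.sum_add_sum_compl D] at hclass
    have hlabeled : (D.filter fun u => ℓ u = a).card = ∑ u ∈ D, if lam u = a then 1 else 0 := by
      rw [Finset.card_filter]
      exact Finset.sum_congr rfl fun u hu => by rw [hlam.2 u hu]
    rw [← hclass, hlabeled, Nat.add_sub_cancel_left]
  -- Count the pairs of an extension and an unlabeled element of label `a` in two ways.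
  calc (labelings size (insert y D) (Function.update ℓ y a)).card * (Fintype.card α - D.card)
      = ∑ z ∈ Dᶜ, ((labelings size D ℓ).filter fun lam => lam z = a).card := by
        rw [← filter_labelings size hy, ← Finset.card_compl, mul_comm, ← smul_eq_mul,
          ← Finset.sum_const]
        exact Finset.sum_congr rfl fun z hz =>
          card_filter_labelings_eq size hy (by simpa using hz) ℓ a
    _ = ∑ lam ∈ labelings size D ℓ, ∑ z ∈ Dᶜ, if lam z = a then 1 else 0 := by
        simp only [Finset.card_filter]
        exact Finset.sum_comm
    _ = (size a - (D.filter fun u => ℓ u = a).card) * (labelings size D ℓ).card := by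
        rw [Finset.sum_congr rfl hunlabeled, Finset.sum_const, smul_eq_mul, mul_comm]

theorem labelings_nonempty (h : ∑ a, size a = Fintype.card α) (D : Finset α) (ℓ : α → L)
    (hD : ∀ a, D.card ≤ size a) : (labelings size D ℓ).Nonempty := by
  induction D using Finset.induction_on with
  | empty =>
    obtain ⟨lam, hlam⟩ := exists_hasClassSizes size h
    exact ⟨lam, (mem_labelings size).2 ⟨hlam, by simp⟩⟩
  | insert y D hy ih =>
    have hlt (a : L) : D.card < size a :=
      (Finset.card_lt_card (Finset.ssubset_insert hy)).trans_le (hD a)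
    have hcount := card_labelings_insert size hy ℓ (ℓ y)
    rw [Function.update_eq_self] at hcount
    have hused : (D.filter fun u => ℓ u = ℓ y).card < size (ℓ y) :=
      (Finset.card_filter_le _ _).trans_lt (hlt _)
    have hpos := Nat.mul_pos (Nat.sub_pos_of_lt hused) (ih fun a => (hlt a).le).card_pos
    rw [← hcount] at hpos
    exact Finset.card_pos.1 (Nat.pos_of_mul_pos_right hpos)

/-- The average of a function over the labelings that extend a partial labeling. It is `0` if there
are none. -/
def labelAvg (D : Finset α) (ℓ : α → L) (F : (α → L) → ℝ≥0∞) : ℝ≥0∞ :=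
  ((labelings size D ℓ).card : ℝ≥0∞)⁻¹ * ∑ lam ∈ labelings size D ℓ, F lam

theorem labelAvg_insert_le {D : Finset α} {y : α} (hy : y ∉ D) (ℓ : α → L) (a : L)
    (F : (α → L) → ℝ≥0∞) :
    ((size a - D.card : ℕ) : ℝ≥0∞) * ((Fintype.card α - D.card : ℕ) : ℝ≥0∞)⁻¹ *
        labelAvg size (insert y D) (Function.update ℓ y a) F ≤
      labelAvg size D ℓ fun lam => if lam y = a then F lam else 0 := by
  have hcount := card_labelings_insert size hy ℓ a
  rw [labelAvg, labelAvg, ← Finset.sum_filter, filter_labelings size hy, ← mul_assoc]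
  gcongr
  have hused : (D.filter fun u => ℓ u = a).card ≤ D.card := Finset.card_filter_le _ _
  have hN : Fintype.card α - D.card ≠ 0 :=
    (Nat.sub_pos_of_lt (Finset.card_lt_univ_of_notMem hy)).ne'
  generalize (labelings size (insert y D) (Function.update ℓ y a)).card = m' at *
  generalize (labelings size D ℓ).card = m at *
  generalize (D.filter fun u => ℓ u = a).card = r at *
  generalize Fintype.card α - D.card = N at *
  rw [mul_assoc, ← ENNReal.mul_inv (by simp [hN]) (by simp), ENNReal.le_inv_iff_mul_le,
    mul_right_comm, ← div_eq_mul_inv]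
  apply ENNReal.div_le_of_le_mul
  rw [one_mul]
  have hle : (size a - D.card) * m ≤ N * m' := by
    rw [mul_comm N, hcount]
    exact Nat.mul_le_mul_right _ (by omega)
  exact_mod_cast hle

theorem labelAvg_insert_insert_le {D : Finset α} {y z : α} (hy : y ∉ D) (hz : z ∉ insert y D)
    (ℓ : α → L) (a : L) (F : (α → L) → ℝ≥0∞) :
    ((size a - D.card : ℕ) : ℝ≥0∞) * ((Fintype.card α - D.card : ℕ) : ℝ≥0∞)⁻¹ *
        (((size a - (insert y D).card : ℕ) : ℝ≥0∞) *
          ((Fintype.card α - (insert y D).card : ℕ) : ℝ≥0∞)⁻¹) *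
        labelAvg size (insert z (insert y D)) (Function.update (Function.update ℓ y a) z a) F ≤
      labelAvg size D ℓ fun lam => if lam y = a then (if lam z = a then F lam else 0) else 0 := by
  refine le_trans ?_ (labelAvg_insert_le size hy ℓ a _)
  rw [mul_assoc]
  gcongr
  exact labelAvg_insert_le size hz _ a F

theorem labelAvg_congr {D : Finset α} {ℓ ℓ' : α → L} (h : ∀ u ∈ D, ℓ u = ℓ' u)
    (F : (α → L) → ℝ≥0∞) : labelAvg size D ℓ F = labelAvg size D ℓ' F := by
  rw [labelAvg, labelAvg, labelings_congr size h]

theorem labelAvg_mono {D : Finset α} {ℓ : α → L} {F F' : (α → L) → ℝ≥0∞}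
    (h : ∀ lam ∈ labelings size D ℓ, F lam ≤ F' lam) :
    labelAvg size D ℓ F ≤ labelAvg size D ℓ F' := by
  unfold labelAvg
  gcongr with lam hlam
  exact h lam hlam

theorem labelAvg_expect {β : Type*} (p : PMF β) (D : Finset α) (ℓ : α → L)
    (F : β → (α → L) → ℝ≥0∞) :
    labelAvg size D ℓ (fun lam => expect p fun b => F b lam) =
      expect p fun b => labelAvg size D ℓ (F b) := by
  simp only [labelAvg, expect_const_mul, expect_sum]

theorem labelAvg_const_mul (c : ℝ≥0∞) (D : Finset α) (ℓ : α → L) (F : (α → L) → ℝ≥0∞) :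
    labelAvg size D ℓ (fun lam => c * F lam) = c * labelAvg size D ℓ F := by
  simp only [labelAvg, ← Finset.mul_sum, mul_left_comm]

theorem labelAvg_sum {β : Type*} (s : Finset β) (D : Finset α) (ℓ : α → L)
    (F : β → (α → L) → ℝ≥0∞) :
    labelAvg size D ℓ (fun lam => ∑ b ∈ s, F b lam) = ∑ b ∈ s, labelAvg size D ℓ (F b) := by
  simp only [labelAvg, Finset.mul_sum]
  exact Finset.sum_comm

theorem labelAvg_const_le (D : Finset α) (ℓ : α → L) (c : ℝ≥0∞) :
    labelAvg size D ℓ (fun _ => c) ≤ c := by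
  rw [labelAvg, Finset.sum_const, nsmul_eq_mul, ← mul_assoc]
  exact mul_le_of_le_one_left zero_le (by rw [mul_comm]; exact ENNReal.mul_inv_le_one _)

theorem labelAvg_const {D : Finset α} {ℓ : α → L} (h : (labelings size D ℓ).Nonempty) (c : ℝ≥0∞) :
    labelAvg size D ℓ (fun _ => c) = c := by
  rw [labelAvg, Finset.sum_const, nsmul_eq_mul, ← mul_assoc,
    ENNReal.inv_mul_cancel (by simp [h.card_pos.ne']) (by simp), one_mul]

end Labelings

theorem sum_sum_update {α β M : Type*} [Fintype α] [DecidableEq α] [Fintype β] [AddCommMonoid M]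
    (u : α) (g : (α → β) → M) :
    ∑ f : α → β, ∑ b, g (Function.update f u b) = Fintype.card β • ∑ f, g f := by
  let e : (α → β) × β ≃ (α → β) × β :=
    { toFun := fun p => (Function.update p.1 u p.2, p.1 u)
      invFun := fun p => (Function.update p.1 u p.2, p.1 u)
      left_inv := fun p => by simp
      right_inv := fun p => by simp }
  calc ∑ f : α → β, ∑ b, g (Function.update f u b)
      = ∑ p : (α → β) × β, g (e p).1 := by rw [Fintype.sum_prod_type]; rfl
    _ = ∑ p : (α → β) × β, g p.1 := e.sum_comp fun p => g p.1
    _ = _ := by rw [Fintype.sum_prod_type]; simp [Finset.smul_sum]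

theorem card_filter_apply_eq {α β : Type*} [Fintype α] [DecidableEq α] [Fintype β] [DecidableEq β]
    {a b : α} (h : a ≠ b) :
    Fintype.card β * (Finset.univ.filter fun f : α → β => f a = f b).card =
      Fintype.card (α → β) := by
  have hsum := sum_sum_update a fun f : α → β => if f a = f b then 1 else 0
  rw [← Finset.card_filter, smul_eq_mul] at hsum
  rw [← hsum]
  simp [Function.update_of_ne h.symm]

section HiddenLabels

variable {α : Type*} [Fintype α] (t s : ℕ)

/-- The class sizes of a labeling of `N` vertices by `t` cliques of size `s` each. The label `none`
marks the low vertices, which lie in no clique. -/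
def cliqueSize (N : ℕ) : Option (Fin t) → ℕ
  | none => N - t * s
  | some _ => s

variable {t s} in
/-- A labeling agrees with what is known about the vertices of `D`: which of them are low, and that
those with the same handle lie in the same clique. -/
structure Compatible (D : Finset α) (τ : α → Option α) (lam : α → Option (Fin t)) : Prop where
  eq_none_iff : ∀ u ∈ D, lam u = none ↔ τ u = none
  eq_of_handle_eq : ∀ u ∈ D, ∀ v ∈ D, τ u = τ v → lam u = lam v

variable [DecidableEq α]

/-- The average over the hidden labelings that are compatible with the vertices seen so far: the
set `D` of seen vertices is divided into low vertices and vertices that lie in cliques with known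
handles. Handles are mapped to cliques by a uniformly random function `φ`, so distinct handles may
refer to the same clique. -/
def hiddenAvg (D : Finset α) (τ : α → Option α) (F : (α → Option (Fin t)) → ℝ≥0∞) : ℝ≥0∞ :=
  (Fintype.card (α → Fin t) : ℝ≥0∞)⁻¹ * ∑ φ : α → Fin t,
    labelAvg (cliqueSize t s (Fintype.card α)) D (Option.map φ ∘ τ) F

variable {t s} {D : Finset α} {τ : α → Option α}

theorem hiddenAvg_mono {F F' : (α → Option (Fin t)) → ℝ≥0∞}
    (h : ∀ lam, HasClassSizes (cliqueSize t s (Fintype.card α)) lam → Compatible D τ lam →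
      F lam ≤ F' lam) :
    hiddenAvg t s D τ F ≤ hiddenAvg t s D τ F' := by
  unfold hiddenAvg
  gcongr with φ
  refine labelAvg_mono _ fun lam hlam => ?_
  obtain ⟨hsize, hext⟩ := (mem_labelings _).1 hlam
  exact h lam hsize
    { eq_none_iff := fun u hu => by simp [hext u hu]
      eq_of_handle_eq := fun u hu v hv huv => by simp [hext u hu, hext v hv, huv] }

theorem hiddenAvg_expect {β : Type*} (p : PMF β) (F : β → (α → Option (Fin t)) → ℝ≥0∞) :
    hiddenAvg t s D τ (fun lam => expect p fun b => F b lam) =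
      expect p fun b => hiddenAvg t s D τ (F b) := by
  simp only [hiddenAvg, labelAvg_expect, expect_const_mul, expect_sum]

theorem hiddenAvg_const_mul (c : ℝ≥0∞) (F : (α → Option (Fin t)) → ℝ≥0∞) :
    hiddenAvg t s D τ (fun lam => c * F lam) = c * hiddenAvg t s D τ F := by
  simp only [hiddenAvg, labelAvg_const_mul, ← Finset.mul_sum, mul_left_comm]

theorem hiddenAvg_sum {β : Type*} (S : Finset β) (F : β → (α → Option (Fin t)) → ℝ≥0∞) :
    hiddenAvg t s D τ (fun lam => ∑ b ∈ S, F b lam) = ∑ b ∈ S, hiddenAvg t s D τ (F b) := by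
  simp only [hiddenAvg, labelAvg_sum]
  rw [Finset.sum_comm, Finset.mul_sum]

theorem hiddenAvg_const_le (c : ℝ≥0∞) : hiddenAvg t s D τ (fun _ => c) ≤ c := by
  calc hiddenAvg t s D τ (fun _ => c)
      ≤ (Fintype.card (α → Fin t) : ℝ≥0∞)⁻¹ * ∑ _φ : α → Fin t, c := by
        unfold hiddenAvg
        gcongr
        exact labelAvg_const_le _ _ _ _
    _ ≤ c := by
        rw [Finset.sum_const, nsmul_eq_mul, ← mul_assoc, Finset.card_univ]
        exact mul_le_of_le_one_left zero_le (by rw [mul_comm]; exact ENNReal.mul_inv_le_one _)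

theorem hiddenAvg_le_one {F : (α → Option (Fin t)) → ℝ≥0∞} (hF : ∀ lam, F lam ≤ 1) :
    hiddenAvg t s D τ F ≤ 1 :=
  (hiddenAvg_mono fun lam _ _ => hF lam).trans (hiddenAvg_const_le 1)

theorem hiddenAvg_const (ht : 0 < t) (hN : t * s ≤ Fintype.card α) (hs : D.card ≤ s)
    (hlow : D.card ≤ Fintype.card α - t * s) (c : ℝ≥0∞) : hiddenAvg t s D τ (fun _ => c) = c := by
  have hnonempty (ℓ) : (labelings (cliqueSize t s (Fintype.card α)) D ℓ).Nonempty := by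
    refine labelings_nonempty _ ?_ D ℓ ?_
    · simp only [cliqueSize, Fintype.sum_option, Finset.sum_const, Finset.card_univ,
        Fintype.card_fin, smul_eq_mul]
      omega
    · rintro (_ | _)
      · exact hlow
      · exact hs
  have : Nonempty (Fin t) := ⟨⟨0, ht⟩⟩
  simp only [hiddenAvg, labelAvg_const _ (hnonempty _)]
  rw [Finset.sum_const, nsmul_eq_mul, ← mul_assoc, Finset.card_univ,
    ENNReal.inv_mul_cancel (Nat.cast_ne_zero.2 Fintype.card_ne_zero) (by simp), one_mul]

theorem hiddenAvg_insert_low_le {y : α} (hy : y ∉ D) (F : (α → Option (Fin t)) → ℝ≥0∞) :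
    ((Fintype.card α - t * s - D.card : ℕ) : ℝ≥0∞) * ((Fintype.card α - D.card : ℕ) : ℝ≥0∞)⁻¹ *
      hiddenAvg t s (insert y D) (Function.update τ y none) F ≤ hiddenAvg t s D τ F := by
  unfold hiddenAvg
  rw [mul_left_comm, Finset.mul_sum]
  gcongr with φ
  rw [Function.comp_update]
  refine (labelAvg_insert_le (cliqueSize t s _) hy _ none F).trans (labelAvg_mono _ fun lam _ => ?_)
  split_ifs
  · exact le_rfl
  · exact zero_le

theorem hiddenAvg_insert_clique_le {x y a : α} (hx : x ∈ D) (hxa : τ x = some a) (hy : y ∉ D)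
    (F : (α → Option (Fin t)) → ℝ≥0∞) :
    ((s - D.card : ℕ) : ℝ≥0∞) * ((Fintype.card α - D.card : ℕ) : ℝ≥0∞)⁻¹ *
      hiddenAvg t s (insert y D) (Function.update τ y (some a)) F ≤
    hiddenAvg t s D τ fun lam => if lam y = lam x then F lam else 0 := by
  unfold hiddenAvg
  rw [mul_left_comm, Finset.mul_sum]
  gcongr with φ
  rw [Function.comp_update]
  refine (labelAvg_insert_le (cliqueSize t s _) hy _ (some (φ a)) F).trans
    (labelAvg_mono _ fun lam hlam => ?_)
  rw [((mem_labelings _).1 hlam).2 x hx, Function.comp_apply, hxa, Option.map_some]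

theorem sum_labelAvg_insert_edge_le (size : Option (Fin t) → ℕ) {m : ℕ}
    (hsize : ∀ j, size (some j) = m) {u v : α} (hu : u ∉ D) (hv : v ∉ insert u D)
    (hτ : ∀ x ∈ D, τ x ≠ some u) (F : (α → Option (Fin t)) → ℝ≥0∞) (φ : α → Fin t) :
    ∑ j, ((m - D.card : ℕ) : ℝ≥0∞) * ((Fintype.card α - D.card : ℕ) : ℝ≥0∞)⁻¹ *
        (((m - (insert u D).card : ℕ) : ℝ≥0∞) *
          ((Fintype.card α - (insert u D).card : ℕ) : ℝ≥0∞)⁻¹) *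
        labelAvg size (insert v (insert u D)) (Option.map (Function.update φ u j) ∘
          Function.update (Function.update τ u (some u)) v (some u)) F ≤
      labelAvg size D (Option.map φ ∘ τ)
        fun lam => if lam u = lam v ∧ lam u ≠ none then F lam else 0 := by
  have hlabel (j : Fin t) : ∀ x ∈ insert v (insert u D), (Option.map (Function.update φ u j) ∘
      Function.update (Function.update τ u (some u)) v (some u)) x =
      Function.update (Function.update (Option.map φ ∘ τ) u (some j)) v (some j) x := by
    intro x hx
    rw [Function.comp_update, Function.comp_update, Option.map_some, Function.update_self]
    by_cases hxv : x = v
    · simp [hxv]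
    by_cases hxu : x = u
    · simp [hxu, Function.update]
    have hxD : x ∈ D := by simpa [hxu, hxv] using hx
    rw [Function.update_of_ne hxv, Function.update_of_ne hxu, Function.update_of_ne hxv,
      Function.update_of_ne hxu]
    rcases hτx : τ x with _ | a
    · simp [hτx]
    · have hau : a ≠ u := fun h => hτ x hxD (h ▸ hτx)
      simp [hτx, Function.update_of_ne hau]
  calc _ ≤ ∑ j, labelAvg size D (Option.map φ ∘ τ) (fun lam =>
        if lam u = some j then (if lam v = some j then F lam else 0) else 0) := by
        gcongr with j
        rw [labelAvg_congr size (hlabel j), ← hsize j]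
        exact labelAvg_insert_insert_le size hu hv _ _ F
    _ = _ := by
        rw [← labelAvg_sum]
        congr 1
        funext lam
        rcases lam u with _ | i
        · simp
        · by_cases h : lam v = some i
          · simp [h]
          · simp [h, Ne.symm h]

theorem hiddenAvg_insert_edge_le {u v : α} (hu : u ∉ D) (hv : v ∉ insert u D)
    (hτ : ∀ x ∈ D, τ x ≠ some u) (F : (α → Option (Fin t)) → ℝ≥0∞) :
    (t : ℝ≥0∞) * (((s - D.card : ℕ) : ℝ≥0∞) * ((Fintype.card α - D.card : ℕ) : ℝ≥0∞)⁻¹ *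
      (((s - (insert u D).card : ℕ) : ℝ≥0∞) *
        ((Fintype.card α - (insert u D).card : ℕ) : ℝ≥0∞)⁻¹)) *
      hiddenAvg t s (insert v (insert u D))
        (Function.update (Function.update τ u (some u)) v (some u)) F ≤
    hiddenAvg t s D τ fun lam => if lam u = lam v ∧ lam u ≠ none then F lam else 0 := by
  set c := ((s - D.card : ℕ) : ℝ≥0∞) * ((Fintype.card α - D.card : ℕ) : ℝ≥0∞)⁻¹ *
      (((s - (insert u D).card : ℕ) : ℝ≥0∞) *
        ((Fintype.card α - (insert u D).card : ℕ) : ℝ≥0∞)⁻¹)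
  set τ' := Function.update (Function.update τ u (some u)) v (some u)
  set size := cliqueSize t s (Fintype.card α)
  unfold hiddenAvg
  calc _ = (Fintype.card (α → Fin t) : ℝ≥0∞)⁻¹ * (c * (Fintype.card (Fin t) •
        ∑ φ : α → Fin t, labelAvg size (insert v (insert u D)) (Option.map φ ∘ τ') F)) := by
        rw [Fintype.card_fin, nsmul_eq_mul]
        ring
    _ = (Fintype.card (α → Fin t) : ℝ≥0∞)⁻¹ * ∑ φ : α → Fin t, ∑ j,
        c * labelAvg size (insert v (insert u D)) (Option.map (Function.update φ u j) ∘ τ') F := by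
        rw [← sum_sum_update u]
        simp only [Finset.mul_sum]
    _ ≤ _ := by
        gcongr with φ
        exact sum_labelAvg_insert_edge_le size (fun _ => rfl) hu hv hτ F φ

theorem hiddenAvg_le_add_inv {x y a b : α} (hx : x ∈ D) (hy : y ∈ D) (hxa : τ x = some a)
    (hyb : τ y = some b) (hab : a ≠ b) {F : (α → Option (Fin t)) → ℝ≥0∞} (hF : ∀ lam, F lam ≤ 1) :
    hiddenAvg t s D τ F ≤
      hiddenAvg t s D τ (fun lam => if lam x ≠ lam y then F lam else 0) + (t : ℝ≥0∞)⁻¹ := by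
  rcases Nat.eq_zero_or_pos t with ht | ht
  · simp [ht]
  have : Nonempty (Fin t) := ⟨⟨0, ht⟩⟩
  have hcard := card_filter_apply_eq (β := Fin t) hab
  rw [Fintype.card_fin] at hcard
  have hcollision : (Finset.univ.filter fun φ : α → Fin t => φ a = φ b).card ≠ 0 := fun h =>
    Fintype.card_ne_zero (α := α → Fin t) (by rw [← hcard, h, mul_zero])
  have hinv : (t : ℝ≥0∞)⁻¹ = (Fintype.card (α → Fin t) : ℝ≥0∞)⁻¹ *
      ∑ φ : α → Fin t, if φ a = φ b then 1 else 0 := by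
    rw [← Finset.natCast_card_filter, ← hcard, Nat.cast_mul, ENNReal.mul_inv (by simp) (by simp),
      mul_assoc, ENNReal.inv_mul_cancel (Nat.cast_ne_zero.2 hcollision) (by simp), mul_one]
  rw [hinv, hiddenAvg, hiddenAvg, ← mul_add, ← Finset.sum_add_distrib]
  gcongr with φ
  by_cases h : φ a = φ b
  · rw [if_pos h]
    exact ((labelAvg_mono _ fun lam _ => hF lam).trans (labelAvg_const_le _ _ _ 1)).trans
      le_add_self
  · rw [if_neg h, add_zero]
    refine labelAvg_mono _ fun lam hlam => ?_
    have hext := ((mem_labelings _).1 hlam).2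
    rw [if_pos]
    simpa [hext x hx, hext y hy, hxa, hyb] using h

end HiddenLabels

section CliqueGraph

variable {V : Finset ℕ} {L : Type*}

/-- The graph in which the hub `h` is adjacent to all other vertices, and vertices with the same
label other than `none` are adjacent. -/
def cliqueGraph (hV : 2 ≤ V.card) (h : V) (lam : V → Option L) : InputGraph V where
  nonempty := ⟨h, h.2⟩
  graph :=
    { Adj := fun u v => u ≠ v ∧ (u = h ∨ v = h ∨ (lam u = lam v ∧ lam u ≠ none))
      symm := ⟨fun u v ⟨huv, hadj⟩ => ⟨huv.symm, by
        rcases hadj with hu | hv | ⟨hlam, hu⟩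
        · exact Or.inr (Or.inl hu)
        · exact Or.inl hv
        · exact Or.inr (Or.inr ⟨hlam.symm, hlam ▸ hu⟩)⟩⟩
      loopless := ⟨fun _ hu => hu.1 rfl⟩ }
  exists_adj v := by
    by_cases hv : v = h
    · have : Nontrivial V := Fintype.one_lt_card_iff_nontrivial.1 (by rwa [Fintype.card_coe])
      obtain ⟨w, hw⟩ := exists_ne v
      exact ⟨w, hw.symm, Or.inl hv⟩
    · exact ⟨h, hv, Or.inr (Or.inl rfl)⟩

variable {hV : 2 ≤ V.card} {h : V} {lam : V → Option L}

theorem cliqueGraph_adj {u v : V} : (cliqueGraph hV h lam).graph.Adj u v ↔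
    u ≠ v ∧ (u = h ∨ v = h ∨ (lam u = lam v ∧ lam u ≠ none)) := Iff.rfl

open scoped Classical in
theorem neighborFinset_hub :
    (cliqueGraph hV h lam).graph.neighborFinset h = Finset.univ.erase h := by
  ext v
  simp only [SimpleGraph.mem_neighborFinset, cliqueGraph_adj, Finset.mem_erase, Finset.mem_univ]
  tauto

open scoped Classical in
theorem neighborFinset_low {v : V} (hv : v ≠ h) (hlow : lam v = none) :
    (cliqueGraph hV h lam).graph.neighborFinset v = {h} := by
  ext w
  simp only [SimpleGraph.mem_neighborFinset, cliqueGraph_adj, Finset.mem_singleton, hlow]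
  grind

open scoped Classical in
theorem neighborFinset_clique {v : V} (hh : lam h = none) (hv : lam v ≠ none) :
    (cliqueGraph hV h lam).graph.neighborFinset v =
      insert h ((Finset.univ.filter fun w => lam w = lam v).erase v) := by
  ext w
  simp only [SimpleGraph.mem_neighborFinset, cliqueGraph_adj, Finset.mem_insert, Finset.mem_erase,
    Finset.mem_filter, Finset.mem_univ, true_and]
  grind

open scoped Classical in
/-- The degree of a vertex of `cliqueGraph hV h lam` if all cliques without the hub have size `s`,
see `deg_cliqueGraph`. -/
def cliqueDeg (s : ℕ) (h : V) (lam : V → Option L) (v : V) : ℕ :=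
  if v = h then V.card - 1 else if lam v = none then 1 else s

variable {t s : ℕ} {lam : V → Option (Fin t)}

theorem deg_cliqueGraph (hh : lam h = none) (hs : 0 < s)
    (hsize : HasClassSizes (cliqueSize t s V.card) lam) (v : V) :
    (cliqueGraph hV h lam).deg v = cliqueDeg s h lam v := by
  classical
  rw [InputGraph.deg, ← SimpleGraph.card_neighborFinset_eq_degree, cliqueDeg]
  split_ifs with hvh hlow
  · rw [hvh, neighborFinset_hub, Finset.card_erase_of_mem (Finset.mem_univ _), Finset.card_univ,
      Fintype.card_coe]
  · rw [neighborFinset_low hvh hlow, Finset.card_singleton]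
  · obtain ⟨j, hj⟩ := Option.ne_none_iff_exists'.1 hlow
    rw [neighborFinset_clique hh hlow, Finset.card_insert_of_notMem (by simp [hh, hj]),
      Finset.card_erase_of_mem (by simp), hj]
    have hclass := hsize (some j)
    rw [cliqueSize] at hclass
    convert Nat.sub_add_cancel hs
    convert hclass

theorem two_mul_numEdges_cliqueGraph (hh : lam h = none) (hs : 0 < s) (hts : t * s < V.card)
    (hsize : HasClassSizes (cliqueSize t s V.card) lam) :
    2 * (cliqueGraph hV h lam).numEdges + t * s + 2 = 2 * V.card + t * s * s := by
  classical
  have hlow : (Finset.univ.filter fun v => lam v = none).card = V.card - t * s := by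
    have hclass := hsize none
    rw [cliqueSize] at hclass
    convert hclass
  have hhigh : (Finset.univ.filter fun v => ¬ lam v = none).card = t * s := by
    have := Finset.card_filter_add_card_filter_not (s := Finset.univ) fun v => lam v = none
    rw [hlow, Finset.card_univ, Fintype.card_coe] at this
    omega
  have hsum : ∑ v, (if lam v = none then 1 else s) = V.card - t * s + t * s * s := by
    rw [Finset.sum_ite, Finset.sum_const, Finset.sum_const, hlow, hhigh, smul_eq_mul, smul_eq_mul,
      mul_one]
  have hdeg : ∀ v ∈ Finset.univ.erase h,
      (cliqueGraph hV h lam).deg v = if lam v = none then 1 else s := fun v hv => by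
    rw [deg_cliqueGraph hh hs hsize, cliqueDeg, if_neg (Finset.ne_of_mem_erase hv)]
  rw [← Finset.add_sum_erase _ _ (Finset.mem_univ h), if_pos hh] at hsum
  rw [← InputGraph.sum_deg, ← Finset.add_sum_erase _ _ (Finset.mem_univ h),
    Finset.sum_congr rfl hdeg, deg_cliqueGraph hh hs hsize, cliqueDeg, if_pos rfl]
  omega

end CliqueGraph

/-- What a query algorithm has seen of a clique graph: a vertex is seen to be low (handle `none`) or
to lie in a clique. Handles stand for cliques, as in `hiddenAvg`. -/
structure SeenState (V : Finset ℕ) where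
  seen : Finset V
  handle : V → Option V

namespace SeenState

variable {V : Finset ℕ}

/-- Marks `v` as seen, with the given handle. -/
def add (σ : SeenState V) (v : V) (o : Option V) : SeenState V :=
  ⟨insert v σ.seen, Function.update σ.handle v o⟩

/-- Reveals that a vertex is low, unless it has been seen already. -/
def reveal (σ : SeenState V) (v : V) : SeenState V :=
  if v ∈ σ.seen then σ else σ.add v none

/-- At most `r` vertices have been seen, the hub `h` is one of them and is low, and all handles are
seen vertices. -/
structure Good (h : V) (r : ℕ) (σ : SeenState V) : Prop where
  hub_mem : h ∈ σ.seen
  hub_low : σ.handle h = none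
  handle_mem : ∀ x ∈ σ.seen, ∀ a, σ.handle x = some a → a ∈ σ.seen
  card_le : σ.seen.card ≤ r

variable {h : V} {r : ℕ} {σ : SeenState V}

theorem Good.mono {r' : ℕ} (hσ : σ.Good h r) (hr : r ≤ r') : σ.Good h r' :=
  ⟨hσ.hub_mem, hσ.hub_low, hσ.handle_mem, hσ.card_le.trans hr⟩

theorem Good.add (hσ : σ.Good h r) {v : V} {o : Option V} (hv : v ∉ σ.seen)
    (ho : ∀ a, o = some a → a ∈ insert v σ.seen) : (σ.add v o).Good h (r + 1) where
  hub_mem := Finset.mem_insert_of_mem hσ.hub_mem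
  hub_low :=
    (Function.update_of_ne (ne_of_mem_of_not_mem hσ.hub_mem hv) _ _).trans hσ.hub_low
  handle_mem x hx a ha := by
    unfold SeenState.add at ha
    by_cases hxv : x = v
    · subst hxv
      exact ho a (by simpa using ha)
    · exact Finset.mem_insert_of_mem (hσ.handle_mem x (Finset.mem_of_mem_insert_of_ne hx hxv) a
        (by simpa [hxv] using ha))
  card_le := (Finset.card_insert_le _ _).trans (Nat.add_le_add_right hσ.card_le 1)

theorem Good.reveal (hσ : σ.Good h r) (v : V) : (σ.reveal v).Good h (r + 1) := by
  unfold SeenState.reveal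
  split_ifs with hv
  · exact hσ.mono (Nat.le_succ r)
  · exact hσ.add hv (by simp)

theorem mem_reveal (σ : SeenState V) (v : V) : v ∈ (σ.reveal v).seen := by
  unfold reveal
  split_ifs with hv
  · exact hv
  · exact Finset.mem_insert_self _ _

theorem seen_subset_reveal (σ : SeenState V) (v : V) : σ.seen ⊆ (σ.reveal v).seen := by
  unfold reveal
  split_ifs
  · exact subset_rfl
  · exact Finset.subset_insert _ _

/-- A uniformly random vertex outside of `D`, or the hub if there is none. -/
def fresh (h : V) (D : Finset V) : PMF V :=
  open scoped Classical in
  if hD : Dᶜ.Nonempty then PMF.uniformOfFinset Dᶜ hD else PMF.pure h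

theorem compl_nonempty {D : Finset V} (hD : D.card < V.card) : Dᶜ.Nonempty := by
  rw [← Finset.card_pos, Finset.card_compl, Fintype.card_coe]
  exact Nat.sub_pos_of_lt hD

theorem expect_fresh {D : Finset V} (hD : D.card < V.card) (f : V → ℝ≥0∞) :
    expect (fresh h D) f = ((V.card - D.card : ℕ) : ℝ≥0∞)⁻¹ * ∑ v ∈ Dᶜ, f v := by
  rw [fresh, dif_pos (compl_nonempty hD), expect_uniformOfFinset, Finset.card_compl,
    Fintype.card_coe]

theorem notMem_of_mem_support_fresh {D : Finset V} (hD : D.card < V.card) {v : V}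
    (hv : v ∈ (fresh h D).support) : v ∉ D := by
  rwa [fresh, dif_pos (compl_nonempty hD), PMF.mem_support_uniformOfFinset_iff,
    Finset.mem_compl] at hv

theorem erase_nonempty (hV : 2 ≤ V.card) (h : V) : (Finset.univ.erase h).Nonempty := by
  rw [← Finset.card_pos, Finset.card_erase_of_mem (Finset.mem_univ _), Finset.card_univ,
    Fintype.card_coe]
  omega

/-- The ideal answer to a random neighbor query at a seen vertex `v`, with the updated state: a
random neighbor in a clique is taken to be unseen. -/
def idealNbr (hV : 2 ≤ V.card) (h : V) (σ : SeenState V) (v : V) : PMF (Option ℕ × SeenState V) :=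
  if v = h then
    (PMF.uniformOfFinset (Finset.univ.erase h) (erase_nonempty hV h)).map
      fun w : V => (some (w : ℕ), σ.reveal w)
  else match σ.handle v with
    | none => PMF.pure (some (h : ℕ), σ)
    | some a => (fresh h σ.seen).map fun w : V => (some (w : ℕ), σ.add w (some a))

open scoped Classical in
/-- A random answer that does not depend on the number of cliques, with the updated state. Random
vertices are taken to be low unless they have been seen, distinct handles are taken to stand for
distinct cliques, and a random edge is taken to join two unseen vertices of a clique without a
handle. -/
def ideal (hV : 2 ≤ V.card) (h : V) (s : ℕ) (σ : SeenState V) :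
    (q : Query) → PMF (q.Answer × SeenState V)
  | .randVert => (PMF.uniformOfFinset Finset.univ (Finset.univ_nonempty_iff.2 ⟨h⟩)).map
      fun v : V => ((v : ℕ), σ.reveal v)
  | .degree x =>
      if hx : x ∈ V then
        let σ' := σ.reveal ⟨x, hx⟩
        PMF.pure (cliqueDeg s h σ'.handle ⟨x, hx⟩, σ')
      else PMF.pure ((0 : ℕ), σ)
  | .pair x y =>
      if hxy : x ∈ V ∧ y ∈ V then
        let σ' := (σ.reveal ⟨x, hxy.1⟩).reveal ⟨y, hxy.2⟩
        PMF.pure (decide ((cliqueGraph hV h σ'.handle).graph.Adj ⟨x, hxy.1⟩ ⟨y, hxy.2⟩), σ')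
      else PMF.pure (false, σ)
  | .randNbr x =>
      if hx : x ∈ V then idealNbr hV h (σ.reveal ⟨x, hx⟩) ⟨x, hx⟩ else PMF.pure (none, σ)
  | .randEdge => (fresh h σ.seen).bind fun u => (fresh h (insert u σ.seen)).map fun v : V =>
      (s((u : ℕ), (v : ℕ)), (σ.add u (some u)).add v (some u))

theorem good_of_mem_support_idealNbr {hV : 2 ≤ V.card} (hσ : σ.Good h r) (hr : r < V.card) {v : V}
    (hv : v ∈ σ.seen) {p : Option ℕ × SeenState V} (hp : p ∈ (idealNbr hV h σ v).support) :
    p.2.Good h (r + 1) := by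
  unfold idealNbr at hp
  split_ifs at hp
  · rw [PMF.mem_support_map_iff] at hp
    obtain ⟨w, -, rfl⟩ := hp
    exact hσ.reveal w
  · cases hhandle : σ.handle v with
    | none =>
      rw [hhandle, PMF.mem_support_pure_iff] at hp
      exact hp ▸ hσ.mono (Nat.le_succ r)
    | some a =>
      rw [hhandle, PMF.mem_support_map_iff] at hp
      obtain ⟨w, hw, rfl⟩ := hp
      refine hσ.add (notMem_of_mem_support_fresh (hσ.card_le.trans_lt hr) hw) ?_
      rintro _ ⟨⟩
      exact Finset.mem_insert_of_mem (hσ.handle_mem v hv a hhandle)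

theorem good_of_mem_support_ideal {hV : 2 ≤ V.card} {s : ℕ} (hσ : σ.Good h r)
    (hr : r + 1 < V.card) {q : Query} {p : q.Answer × SeenState V}
    (hp : p ∈ (ideal hV h s σ q).support) : p.2.Good h (r + 2) := by
  have hr2 : r ≤ r + 2 := Nat.le_add_right r 2
  cases q with
  | randVert =>
    obtain ⟨v, -, rfl⟩ := (PMF.mem_support_map_iff _ _ _).1 hp
    exact (hσ.reveal v).mono (Nat.le_succ _)
  | degree x =>
    rw [ideal] at hp
    split_ifs at hp <;> rw [PMF.mem_support_pure_iff] at hp <;> subst hp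
    · exact (hσ.reveal _).mono (Nat.le_succ _)
    · exact hσ.mono hr2
  | pair x y =>
    rw [ideal] at hp
    split_ifs at hp <;> rw [PMF.mem_support_pure_iff] at hp <;> subst hp
    · exact (hσ.reveal _).reveal _
    · exact hσ.mono hr2
  | randNbr x =>
    by_cases hx : x ∈ V
    · rw [show ideal hV h s σ (.randNbr x) = _ from dif_pos hx] at hp
      exact good_of_mem_support_idealNbr (hσ.reveal _) hr (mem_reveal _ _) hp
    · rw [show ideal hV h s σ (.randNbr x) = _ from dif_neg hx] at hp
      exact (PMF.mem_support_pure_iff _ _).1 hp ▸ hσ.mono hr2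
  | randEdge =>
    obtain ⟨u, hu, hp⟩ := (PMF.mem_support_bind_iff _ _ _).1 hp
    obtain ⟨v, hv, rfl⟩ := (PMF.mem_support_map_iff _ _ _).1 hp
    have hu' : u ∉ σ.seen := notMem_of_mem_support_fresh (hσ.card_le.trans_lt (by omega)) hu
    have hσu : (σ.add u (some u)).Good h (r + 1) := hσ.add hu' (by simp)
    refine hσu.add (notMem_of_mem_support_fresh (hσu.card_le.trans_lt hr) hv) ?_
    rintro _ ⟨⟩
    exact Finset.mem_insert_of_mem (Finset.mem_insert_self _ _)

end SeenState

theorem le_add_of_mul_le {c X Y δ : ℝ≥0∞} (hc : 1 ≤ c + δ) (hX : X ≤ 1) (h : c * X ≤ Y) :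
    X ≤ Y + δ :=
  calc X ≤ (c + δ) * X := le_mul_of_one_le_left zero_le hc
    _ = c * X + δ * X := add_mul _ _ _
    _ ≤ Y + δ := add_le_add h (mul_le_of_le_one_right zero_le hX)

/-- The error `δ` bounds the probability that a query to a clique graph with `n` vertices and `t`
cliques of size `s` reveals something unexpected, as long as at most `R` vertices have been seen. -/
structure CliqueParams (n t s R : ℕ) (δ : ℝ≥0∞) : Prop where
  t_pos : 0 < t
  lt_s : R < s
  lt_n : R + t * s < n
  low : ∀ r ≤ R, 1 ≤ ((n - t * s - r : ℕ) : ℝ≥0∞) * ((n - r : ℕ) : ℝ≥0∞)⁻¹ + δ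
  nbr : ∀ r ≤ R, 1 ≤ (s : ℝ≥0∞)⁻¹ * ((s - r : ℕ) : ℝ≥0∞) + δ
  pair : (t : ℝ≥0∞)⁻¹ ≤ δ
  edge : ∀ r ≤ R, 1 ≤ ((2 * n + t * s * s - t * s - 2 : ℕ) : ℝ≥0∞)⁻¹ *
    ((t * ((s - r) * (s - (r + 1))) : ℕ) : ℝ≥0∞) + δ

theorem CliqueParams.add_one_lt {n t s R : ℕ} {δ : ℝ≥0∞} (hP : CliqueParams n t s R δ) :
    R + 1 < n := by
  have := hP.lt_s
  have := hP.lt_n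
  have := Nat.le_mul_of_pos_left s hP.t_pos
  omega

namespace SeenState

variable {V : Finset ℕ} {t s r R : ℕ} {δ : ℝ≥0∞} {h : V} {σ : SeenState V}

/-- The average over the hidden labelings that are compatible with a state. -/
def avg (t s : ℕ) (σ : SeenState V) (F : (V → Option (Fin t)) → ℝ≥0∞) : ℝ≥0∞ :=
  hiddenAvg t s σ.seen σ.handle F

theorem avg_mono {F F' : (V → Option (Fin t)) → ℝ≥0∞}
    (h : ∀ lam, HasClassSizes (cliqueSize t s V.card) lam → Compatible σ.seen σ.handle lam →
      F lam ≤ F' lam) : avg t s σ F ≤ avg t s σ F' := by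
  rw [← Fintype.card_coe V] at h
  exact hiddenAvg_mono h

theorem avg_congr {F F' : (V → Option (Fin t)) → ℝ≥0∞}
    (h : ∀ lam, HasClassSizes (cliqueSize t s V.card) lam → Compatible σ.seen σ.handle lam →
      F lam = F' lam) : avg t s σ F = avg t s σ F' :=
  (avg_mono fun lam hsize hlam => (h lam hsize hlam).le).antisymm
    (avg_mono fun lam hsize hlam => (h lam hsize hlam).ge)

theorem avg_le_one {F : (V → Option (Fin t)) → ℝ≥0∞} (hF : ∀ lam, F lam ≤ 1) :
    avg t s σ F ≤ 1 := hiddenAvg_le_one hF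

theorem expect_le_avg {β : Type*} (p : PMF β) {f : β → ℝ≥0∞}
    {K : β → (V → Option (Fin t)) → ℝ≥0∞} (hf : ∀ b, f b ≤ avg t s σ (K b) + δ) :
    expect p f ≤ avg t s σ (fun lam => expect p fun b => K b lam) + δ := by
  rw [avg, hiddenAvg_expect, ← expect_const p δ, ← expect_add]
  exact expect_mono hf

theorem avg_reveal_le (hP : CliqueParams V.card t s R δ) (hR : σ.seen.card ≤ R) (v : V)
    {F : (V → Option (Fin t)) → ℝ≥0∞} (hF : ∀ lam, F lam ≤ 1) :
    avg t s (σ.reveal v) F ≤ avg t s σ F + δ := by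
  unfold reveal
  split_ifs with hv
  · exact le_self_add
  · have hlow := hP.low _ hR
    rw [← Fintype.card_coe V] at hlow
    exact le_add_of_mul_le hlow (avg_le_one hF) (hiddenAvg_insert_low_le hv F)

variable {hV : 2 ≤ V.card}

theorem ideal_randVert_le (hP : CliqueParams V.card t s R δ) (hσ : σ.Good h R)
    (K : Query.randVert.Answer → (V → Option (Fin t)) → ℝ≥0∞) (hK : ∀ a lam, K a lam ≤ 1) :
    expect (ideal hV h s σ .randVert) (fun p => avg t s p.2 (K p.1)) ≤
      avg t s σ (fun lam => expect ((cliqueGraph hV h lam).oracle .randVert) fun a => K a lam) +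
        δ := by
  have horacle (lam) : expect ((cliqueGraph hV h lam).oracle .randVert) (fun a => K a lam) =
      expect (PMF.uniformOfFinset Finset.univ (Finset.univ_nonempty_iff.2 ⟨h⟩))
        fun v : V => K (v : ℕ) lam := by
    rw [expect_uniformOfFinset, Finset.card_univ, Fintype.card_coe]
    exact InputGraph.expect_oracle_randVert _ _
  simp only [horacle]
  exact (expect_map _ _ _).trans_le
    (expect_le_avg _ fun v => avg_reveal_le hP hσ.card_le v (hK _))

theorem ideal_degree_le (hP : CliqueParams V.card t s R δ) (hσ : σ.Good h R) (x : ℕ)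
    (K : (Query.degree x).Answer → (V → Option (Fin t)) → ℝ≥0∞) (hK : ∀ a lam, K a lam ≤ 1) :
    expect (ideal hV h s σ (.degree x)) (fun p => avg t s p.2 (K p.1)) ≤
      avg t s σ (fun lam => expect ((cliqueGraph hV h lam).oracle (.degree x)) fun a => K a lam) +
        δ := by
  by_cases hx : x ∈ V
  · have hσ' := hσ.reveal ⟨x, hx⟩
    refine le_trans (le_of_eq ?_)
      (avg_reveal_le hP hσ.card_le ⟨x, hx⟩ fun lam => expect_le_one _ fun a => hK a lam)
    rw [show ideal hV h s σ (.degree x) = _ from dif_pos hx, expect_pure]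
    refine avg_congr fun lam hsize hlam => ?_
    have hdeg : (cliqueGraph hV h lam).deg ⟨x, hx⟩ =
        cliqueDeg s h (σ.reveal ⟨x, hx⟩).handle ⟨x, hx⟩ := by
      rw [deg_cliqueGraph ((hlam.eq_none_iff h hσ'.hub_mem).2 hσ'.hub_low)
        (Nat.zero_lt_of_lt hP.lt_s) hsize, cliqueDeg, cliqueDeg]
      simp only [hlam.eq_none_iff _ (mem_reveal _ _)]
    rw [(cliqueGraph hV h lam).oracle_degree ⟨x, hx⟩, hdeg]
    exact (expect_pure (α := ℕ) _ fun a => K a lam).symm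
  · have horacle (lam : V → Option (Fin t)) :
        (cliqueGraph hV h lam).oracle (.degree x) = PMF.pure (α := ℕ) 0 :=
      congrArg PMF.pure (dif_neg hx)
    rw [show ideal hV h s σ (.degree x) = _ from dif_neg hx, expect_pure]
    refine le_trans (le_of_eq (avg_congr fun lam _ _ => ?_)) le_self_add
    rw [horacle]
    exact (expect_pure (α := ℕ) 0 fun a => K a lam).symm

open scoped Classical in
theorem avg_pair_le (hlow : σ.handle h = none) {u v : V} (hu : u ∈ σ.seen) (hv : v ∈ σ.seen)
    (K : Bool → (V → Option (Fin t)) → ℝ≥0∞) (hK : ∀ a lam, K a lam ≤ 1) :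
    avg t s σ (K (decide ((cliqueGraph hV h σ.handle).graph.Adj u v))) ≤
      avg t s σ (fun lam => K (decide ((cliqueGraph hV h lam).graph.Adj u v)) lam) +
        (t : ℝ≥0∞)⁻¹ := by
  simp only [cliqueGraph_adj]
  by_cases hsep : ∃ a b, σ.handle u = some a ∧ σ.handle v = some b ∧ a ≠ b
  · obtain ⟨a, b, ha, hb, hab⟩ := hsep
    have huh : u ≠ h := by
      rintro rfl
      simp [hlow] at ha
    have hvh : v ≠ h := by
      rintro rfl
      simp [hlow] at hb
    refine (hiddenAvg_le_add_inv hu hv ha hb hab (hK _)).trans (add_le_add_left ?_ _)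
    refine avg_mono fun lam _ _ => ?_
    split_ifs with hlam
    · simp [huh, hvh, ha, hb, hab, hlam]
    · exact zero_le
  · refine le_trans (le_of_eq (avg_congr fun lam _ hlam => ?_)) le_self_add
    have hadj : (σ.handle u = σ.handle v ∧ σ.handle u ≠ none) ↔ lam u = lam v ∧ lam u ≠ none := by
      have hu0 := hlam.eq_none_iff u hu
      have hv0 := hlam.eq_none_iff v hv
      have huv := hlam.eq_of_handle_eq u hu v hv
      cases hσu : σ.handle u <;> cases hσv : σ.handle v <;> grind
    simp only [hadj]

theorem ideal_pair_le (hP : CliqueParams V.card t s R δ) (hσ : σ.Good h r) (hr : r + 1 ≤ R)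
    (x y : ℕ) (K : (Query.pair x y).Answer → (V → Option (Fin t)) → ℝ≥0∞)
    (hK : ∀ a lam, K a lam ≤ 1) :
    expect (ideal hV h s σ (.pair x y)) (fun p => avg t s p.2 (K p.1)) ≤
      avg t s σ (fun lam => expect ((cliqueGraph hV h lam).oracle (.pair x y)) fun a => K a lam) +
        3 * δ := by
  classical
  by_cases hxy : x ∈ V ∧ y ∈ V
  · let u : V := ⟨x, hxy.1⟩
    let v : V := ⟨y, hxy.2⟩
    let F (lam : V → Option (Fin t)) : ℝ≥0∞ :=
      K (decide ((cliqueGraph hV h lam).graph.Adj u v)) lam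
    have hF (lam) : F lam ≤ 1 := hK _ lam
    have hσu := hσ.reveal u
    have horacle (lam) :
        expect ((cliqueGraph hV h lam).oracle (.pair x y)) (fun a => K a lam) = F lam := by
      rw [(cliqueGraph hV h lam).oracle_pair u v]
      exact expect_pure _ _
    rw [show ideal hV h s σ (.pair x y) = _ from dif_pos hxy, expect_pure]
    simp only [horacle]
    calc _ ≤ avg t s ((σ.reveal u).reveal v) F + (t : ℝ≥0∞)⁻¹ :=
          avg_pair_le (hσu.reveal v).hub_low (seen_subset_reveal _ _ (mem_reveal _ _))
            (mem_reveal _ _) K hK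
      _ ≤ avg t s σ F + δ + δ + δ := by
          refine add_le_add ?_ hP.pair
          refine (avg_reveal_le hP (hσu.card_le.trans hr) v hF).trans ?_
          gcongr
          exact avg_reveal_le hP (hσ.card_le.trans (Nat.le_of_succ_le hr)) u hF
      _ = avg t s σ F + 3 * δ := by ring
  · have horacle (lam : V → Option (Fin t)) :
        (cliqueGraph hV h lam).oracle (.pair x y) = PMF.pure (α := Bool) false :=
      congrArg PMF.pure (decide_eq_false fun ⟨hx, hy, _⟩ => hxy ⟨hx, hy⟩)
    rw [show ideal hV h s σ (.pair x y) = _ from dif_neg hxy, expect_pure]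
    refine le_trans (le_of_eq (avg_congr fun lam _ _ => ?_)) le_self_add
    rw [horacle]
    exact (expect_pure (α := Bool) false fun a => K a lam).symm

open scoped Classical in
theorem idealNbr_le_of_handle (hP : CliqueParams V.card t s R δ) (hσ : σ.Good h R) {v a : V}
    (hv : v ∈ σ.seen) (hva : σ.handle v = some a) (K : Option ℕ → (V → Option (Fin t)) → ℝ≥0∞)
    (hK : ∀ a lam, K a lam ≤ 1) :
    (expect (fresh h σ.seen) fun w => avg t s (σ.add w (some a)) (K (some (w : ℕ)))) ≤
      avg t s σ (fun lam => (s : ℝ≥0∞)⁻¹ *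
        ∑ w ∈ (cliqueGraph hV h lam).graph.neighborFinset v, K (some (w : ℕ)) lam) + δ := by
  have hcard : σ.seen.card < V.card := hσ.card_le.trans_lt ((Nat.le_add_right _ _).trans_lt hP.lt_n)
  refine le_add_of_mul_le (hP.nbr _ hσ.card_le)
    (expect_le_one _ fun w => avg_le_one (hK _)) ?_
  rw [expect_fresh hcard]
  calc _ = (s : ℝ≥0∞)⁻¹ * ∑ w ∈ σ.seenᶜ, ((s - σ.seen.card : ℕ) : ℝ≥0∞) *
          ((Fintype.card V - σ.seen.card : ℕ) : ℝ≥0∞)⁻¹ *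
          avg t s (σ.add w (some a)) (K (some (w : ℕ))) := by
        rw [← Finset.mul_sum, Fintype.card_coe]
        ring
    _ ≤ (s : ℝ≥0∞)⁻¹ * ∑ w ∈ σ.seenᶜ, avg t s σ (fun lam =>
          if lam w = lam v then K (some (w : ℕ)) lam else 0) := by
        gcongr with w hw
        exact hiddenAvg_insert_clique_le hv hva (Finset.mem_compl.1 hw) _
    _ = avg t s σ (fun lam => (s : ℝ≥0∞)⁻¹ *
          ∑ w ∈ σ.seenᶜ with lam w = lam v, K (some (w : ℕ)) lam) := by
        simp only [avg, hiddenAvg_const_mul, ← hiddenAvg_sum, Finset.sum_filter]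
    _ ≤ _ := by
        refine avg_mono fun lam _ hlam => ?_
        have hh : lam h = none := (hlam.eq_none_iff h hσ.hub_mem).2 hσ.hub_low
        have hlv : lam v ≠ none := by simp [hlam.eq_none_iff v hv, hva]
        gcongr
        intro w hw
        simp only [Finset.mem_filter, Finset.mem_compl] at hw
        simp only [neighborFinset_clique hh hlv, Finset.mem_insert, Finset.mem_erase,
          Finset.mem_filter, Finset.mem_univ, true_and]
        exact Or.inr ⟨(ne_of_mem_of_not_mem hv hw.1).symm, hw.2⟩

theorem idealNbr_le (hP : CliqueParams V.card t s R δ) (hσ : σ.Good h R) {v : V}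
    (hv : v ∈ σ.seen) (K : Option ℕ → (V → Option (Fin t)) → ℝ≥0∞)
    (hK : ∀ a lam, K a lam ≤ 1) :
    expect (idealNbr hV h σ v) (fun p => avg t s p.2 (K p.1)) ≤
      avg t s σ (fun lam => expect (α := Option ℕ) ((cliqueGraph hV h lam).oracle (.randNbr v))
        fun a => K a lam) + δ := by
  classical
  unfold idealNbr
  simp only [InputGraph.expect_oracle_randNbr]
  split_ifs with hvh
  · subst hvh
    have hunif (lam) : ((cliqueGraph hV v lam).deg v : ℝ≥0∞)⁻¹ *
        ∑ w ∈ (cliqueGraph hV v lam).graph.neighborFinset v, K (some (w : ℕ)) lam =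
        expect (PMF.uniformOfFinset (Finset.univ.erase v) (erase_nonempty hV v))
          fun w => K (some (w : ℕ)) lam := by
      rw [expect_uniformOfFinset, InputGraph.deg, ← SimpleGraph.card_neighborFinset_eq_degree,
        neighborFinset_hub]
    rw [expect_map]
    simp only [hunif]
    exact expect_le_avg _ fun w => avg_reveal_le hP hσ.card_le w (hK _)
  · cases hhandle : σ.handle v with
    | none =>
      refine le_trans (le_of_eq ?_) le_self_add
      rw [expect_pure]
      refine avg_congr fun lam _ hlam => ?_
      have hlow : lam v = none := (hlam.eq_none_iff v hv).2 hhandle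
      rw [InputGraph.deg, ← SimpleGraph.card_neighborFinset_eq_degree,
        neighborFinset_low hvh hlow]
      simp
    | some a =>
      rw [expect_map]
      refine (idealNbr_le_of_handle (hV := hV) hP hσ hv hhandle K hK).trans_eq ?_
      congr 1
      refine avg_congr fun lam hsize hlam => ?_
      rw [deg_cliqueGraph ((hlam.eq_none_iff h hσ.hub_mem).2 hσ.hub_low)
        (Nat.zero_lt_of_lt hP.lt_s) hsize, cliqueDeg, if_neg hvh,
        if_neg (by simp [hlam.eq_none_iff v hv, hhandle])]

theorem ideal_randNbr_le (hP : CliqueParams V.card t s R δ) (hσ : σ.Good h r) (hr : r + 1 ≤ R)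
    (x : ℕ) (K : (Query.randNbr x).Answer → (V → Option (Fin t)) → ℝ≥0∞)
    (hK : ∀ a lam, K a lam ≤ 1) :
    expect (ideal hV h s σ (.randNbr x)) (fun p => avg t s p.2 (K p.1)) ≤
      avg t s σ (fun lam => expect ((cliqueGraph hV h lam).oracle (.randNbr x)) fun a => K a lam) +
        2 * δ := by
  by_cases hx : x ∈ V
  · rw [show ideal hV h s σ (.randNbr x) = _ from dif_pos hx]
    refine (idealNbr_le hP ((hσ.reveal ⟨x, hx⟩).mono hr) (mem_reveal _ _) K hK).trans ?_
    rw [two_mul, ← add_assoc]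
    gcongr
    exact avg_reveal_le hP (hσ.card_le.trans (Nat.le_of_succ_le hr)) _ fun lam =>
      expect_le_one _ fun a => hK a lam
  · have horacle (lam : V → Option (Fin t)) :
        (cliqueGraph hV h lam).oracle (.randNbr x) = PMF.pure (α := Option ℕ) none := dif_neg hx
    rw [show ideal hV h s σ (.randNbr x) = _ from dif_neg hx, expect_pure]
    refine le_trans (le_of_eq (avg_congr fun lam _ _ => ?_)) le_self_add
    rw [horacle]
    exact (expect_pure (α := Option ℕ) none fun a => K a lam).symm

theorem expect_fresh_fresh {D : Finset V} (hD : D.card + 1 < V.card) (f : V → V → ℝ≥0∞) :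
    (expect (fresh h D) fun u => expect (fresh h (insert u D)) (f u)) =
      ((V.card - D.card : ℕ) : ℝ≥0∞)⁻¹ * (((V.card - (D.card + 1) : ℕ) : ℝ≥0∞)⁻¹ *
        ∑ u ∈ Dᶜ, ∑ v ∈ (insert u D)ᶜ, f u v) := by
  rw [expect_fresh (Nat.lt_of_succ_lt hD)]
  congr 1
  refine (Finset.sum_congr rfl fun u hu => ?_).trans (Finset.mul_sum _ _ _).symm
  have hcard : (insert u D).card = D.card + 1 :=
    Finset.card_insert_of_notMem (Finset.mem_compl.1 hu)
  rw [expect_fresh (hcard.trans_lt hD), hcard]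

open scoped Classical in
theorem sum_le_expect_oracle_randEdge {lam : V → Option (Fin t)} (hh : lam h = none) (hs : 0 < s)
    (hts : t * s < V.card) (hsize : HasClassSizes (cliqueSize t s V.card) lam) (D : Finset V)
    (F : Sym2 ℕ → ℝ≥0∞) :
    ((2 * V.card + t * s * s - t * s - 2 : ℕ) : ℝ≥0∞)⁻¹ * ∑ u ∈ Dᶜ, ∑ v ∈ (insert u D)ᶜ,
        (if lam u = lam v ∧ lam u ≠ none then F s((u : ℕ), (v : ℕ)) else 0) ≤
      expect (α := Sym2 ℕ) ((cliqueGraph hV h lam).oracle .randEdge) F := by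
  have hedges : 2 * V.card + t * s * s - t * s - 2 = 2 * (cliqueGraph hV h lam).numEdges := by
    have := two_mul_numEdges_cliqueGraph (hV := hV) hh hs hts hsize
    omega
  have hhalves (u v : V) : F s((u : ℕ), (v : ℕ)) =
      2⁻¹ * F s((u : ℕ), (v : ℕ)) + 2⁻¹ * F s((v : ℕ), (u : ℕ)) := by
    rw [Sym2.eq_swap (a := (v : ℕ)), ← add_mul, ENNReal.inv_two_add_inv_two, one_mul]
  rw [InputGraph.expect_oracle_randEdge _ _ _ hhalves, hedges, Nat.cast_mul, Nat.cast_ofNat,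
    ENNReal.mul_inv (by simp) (by simp), mul_comm 2⁻¹, mul_assoc]
  gcongr
  simp only [InputGraph.dartSum, Finset.mul_sum]
  refine (Finset.sum_le_sum fun u _ => ?_).trans
    (Finset.sum_le_sum_of_subset (Finset.subset_univ _))
  refine (Finset.sum_le_sum fun v hv => ?_).trans
    (Finset.sum_le_sum_of_subset (Finset.subset_univ _))
  have huv : u ≠ v := fun huv => Finset.mem_compl.1 hv (huv ▸ Finset.mem_insert_self u D)
  rw [cliqueGraph_adj, mul_ite, mul_zero]
  split_ifs with hlam hadj
  · exact le_rfl
  · exact absurd ⟨huv, Or.inr (Or.inr hlam)⟩ hadj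
  all_goals exact zero_le

theorem avg_add_add_le (hσ : σ.Good h r) {u v : V} (hu : u ∉ σ.seen) (hv : v ∉ insert u σ.seen)
    (F : (V → Option (Fin t)) → ℝ≥0∞) :
    t * (((s - σ.seen.card : ℕ) : ℝ≥0∞) * ((V.card - σ.seen.card : ℕ) : ℝ≥0∞)⁻¹ *
        (((s - (σ.seen.card + 1) : ℕ) : ℝ≥0∞) * ((V.card - (σ.seen.card + 1) : ℕ) : ℝ≥0∞)⁻¹)) *
        avg t s ((σ.add u (some u)).add v (some u)) F ≤
      avg t s σ fun lam => if lam u = lam v ∧ lam u ≠ none then F lam else 0 := by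
  have hinsert := hiddenAvg_insert_edge_le (t := t) (s := s) (τ := σ.handle) hu hv
    (fun x hx hxu => hu (hσ.handle_mem x hx u hxu)) F
  rwa [Finset.card_insert_of_notMem hu, Fintype.card_coe] at hinsert

theorem ideal_randEdge_le (hP : CliqueParams V.card t s R δ) (hσ : σ.Good h R)
    (K : Query.randEdge.Answer → (V → Option (Fin t)) → ℝ≥0∞) (hK : ∀ a lam, K a lam ≤ 1) :
    expect (ideal hV h s σ .randEdge) (fun p => avg t s p.2 (K p.1)) ≤
      avg t s σ (fun lam => expect ((cliqueGraph hV h lam).oracle .randEdge) fun a => K a lam) +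
        δ := by
  classical
  have hseen : σ.seen.card + 1 < V.card :=
    (Nat.add_le_add_right hσ.card_le 1).trans_lt hP.add_one_lt
  let r := σ.seen.card
  let M : ℕ := 2 * V.card + t * s * s - t * s - 2
  let c : ℝ≥0∞ := t * (((s - r : ℕ) : ℝ≥0∞) * ((V.card - r : ℕ) : ℝ≥0∞)⁻¹ *
    (((s - (r + 1) : ℕ) : ℝ≥0∞) * ((V.card - (r + 1) : ℕ) : ℝ≥0∞)⁻¹))
  let σ' (u v : V) := (σ.add u (some u)).add v (some u)
  have hideal : expect (ideal hV h s σ .randEdge) (fun p => avg t s p.2 (K p.1)) =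
      expect (fresh h σ.seen) fun u => expect (fresh h (insert u σ.seen)) fun v =>
        avg t s (σ' u v) (K s((u : ℕ), (v : ℕ))) :=
    (expect_bind _ _ _).trans (congrArg _ (funext fun u => expect_map _ _ _))
  refine le_add_of_mul_le (hP.edge _ hσ.card_le) (expect_le_one _ fun p => avg_le_one (hK _)) ?_
  rw [hideal, expect_fresh_fresh hseen]
  calc _ = (M : ℝ≥0∞)⁻¹ * ∑ u ∈ σ.seenᶜ, ∑ v ∈ (insert u σ.seen)ᶜ,
          c * avg t s (σ' u v) (K s((u : ℕ), (v : ℕ))) := by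
        simp only [← Finset.mul_sum, c, r, M, Nat.cast_mul]
        ring
    _ ≤ (M : ℝ≥0∞)⁻¹ * ∑ u ∈ σ.seenᶜ, ∑ v ∈ (insert u σ.seen)ᶜ, avg t s σ (fun lam =>
          if lam u = lam v ∧ lam u ≠ none then K s((u : ℕ), (v : ℕ)) lam else 0) := by
        gcongr with u hu v hv
        exact avg_add_add_le hσ (Finset.mem_compl.1 hu) (Finset.mem_compl.1 hv) _
    _ = avg t s σ (fun lam => (M : ℝ≥0∞)⁻¹ * ∑ u ∈ σ.seenᶜ, ∑ v ∈ (insert u σ.seen)ᶜ,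
          if lam u = lam v ∧ lam u ≠ none then K s((u : ℕ), (v : ℕ)) lam else 0) := by
        simp only [avg, hiddenAvg_const_mul, hiddenAvg_sum]
    _ ≤ _ := avg_mono fun lam hsize hlam =>
        sum_le_expect_oracle_randEdge ((hlam.eq_none_iff h hσ.hub_mem).2 hσ.hub_low)
          (Nat.zero_lt_of_lt hP.lt_s) (Nat.lt_of_add_left_lt hP.lt_n) hsize σ.seen fun a => K a lam

theorem ideal_le (hP : CliqueParams V.card t s R δ) (hσ : σ.Good h r) (hr : r + 1 ≤ R) (q : Query)
    (K : q.Answer → (V → Option (Fin t)) → ℝ≥0∞) (hK : ∀ a lam, K a lam ≤ 1) :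
    expect (ideal hV h s σ q) (fun p => avg t s p.2 (K p.1)) ≤
      avg t s σ (fun lam => expect ((cliqueGraph hV h lam).oracle q) fun a => K a lam) +
        3 * δ := by
  have hσR : σ.Good h R := hσ.mono (Nat.le_of_succ_le hr)
  have h13 : δ ≤ 3 * δ := le_mul_of_one_le_left zero_le (by norm_num)
  have h23 : 2 * δ ≤ 3 * δ := by gcongr; norm_num
  cases q with
  | randVert => exact (ideal_randVert_le hP hσR K hK).trans (add_le_add_right h13 _)
  | degree x => exact (ideal_degree_le hP hσR x K hK).trans (add_le_add_right h13 _)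
  | pair x y => exact ideal_pair_le hP hσ hr x y K hK
  | randNbr x => exact (ideal_randNbr_le hP hσ hr x K hK).trans (add_le_add_right h23 _)
  | randEdge => exact (ideal_randEdge_le hP hσR K hK).trans (add_le_add_right h13 _)

end SeenState

theorem toOuterMeasure_add_compl {α : Type*} (p : PMF α) (S : Set α) :
    p.toOuterMeasure S + p.toOuterMeasure Sᶜ = 1 := by
  rw [← expect_indicator_one, ← expect_indicator_one, ← expect_add, ← expect_const p 1]
  simp only [Set.indicator_self_add_compl_apply, Pi.one_apply]

theorem toOuterMeasure_compl_le_one_third {α : Type*} {p : PMF α} {S : Set α}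
    (h : 2 / 3 ≤ p.toOuterMeasure S) : p.toOuterMeasure Sᶜ ≤ 1 / 3 := by
  have hthirds : (2 / 3 + 1 / 3 : ℝ≥0∞) = 1 := by
    rw [← ENNReal.add_div, two_add_one_eq_three, ENNReal.div_self (by simp) (by simp)]
  have hle : 2 / 3 + p.toOuterMeasure Sᶜ ≤ 2 / 3 + 1 / 3 := by
    rw [hthirds, ← toOuterMeasure_add_compl p S]
    gcongr
  exact ENNReal.le_of_add_le_add_left (ENNReal.div_ne_top (by simp) (by simp)) hle

/-- The average degree of a clique graph with `n` vertices and `t` cliques of size `s`. -/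
def cliqueAvgDegree (n t s : ℕ) : ℝ := (2 * n + t * s * s - t * s - 2) / n

theorem avgDegree_cliqueGraph {V : Finset ℕ} {t s : ℕ} {hV : 2 ≤ V.card} {h : V}
    {lam : V → Option (Fin t)} (hh : lam h = none) (hs : 0 < s) (hts : t * s < V.card)
    (hsize : HasClassSizes (cliqueSize t s V.card) lam) :
    (cliqueGraph hV h lam).avgDegree = cliqueAvgDegree V.card t s := by
  have hedges : (2 * (cliqueGraph hV h lam).numEdges + t * s + 2 : ℝ) =
      2 * V.card + t * s * s := mod_cast two_mul_numEdges_cliqueGraph hh hs hts hsize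
  rw [InputGraph.avgDegree, cliqueAvgDegree]
  congr 1
  linarith

namespace SeenState

variable {V : Finset ℕ} {t s r R : ℕ} {δ : ℝ≥0∞} {h : V} {hV : 2 ≤ V.card} {σ : SeenState V}

theorem avg_const (hP : CliqueParams V.card t s R δ) (hσ : σ.Good h R) (c : ℝ≥0∞) :
    avg t s σ (fun _ => c) = c := by
  have hcard := hσ.card_le
  have hs := hP.lt_s
  have hn := hP.lt_n
  rw [← Fintype.card_coe V] at hn
  exact hiddenAvg_const hP.t_pos (by omega) (by omega) (by omega) c

/-- The outcome of running an algorithm for at most `b` queries with ideal answers. -/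
def idealRun (hV : 2 ≤ V.card) (h : V) (s : ℕ) (A : QueryAlgorithm) :
    ℕ → SeenState V → A.State → PMF (Option ℝ)
  | 0, _, st => (A.step st).bind fun
      | .output r => PMF.pure (some r)
      | .query _ _ => PMF.pure none
  | b + 1, σ, st => (A.step st).bind fun
      | .output r => PMF.pure (some r)
      | .query q next => (ideal hV h s σ q).bind fun p => idealRun hV h s A b p.2 (next p.1)

theorem idealRun_le (hP : CliqueParams V.card t s R δ) (A : QueryAlgorithm)
    {f : Option ℝ → ℝ≥0∞} (hf : ∀ o, f o ≤ 1) {b : ℕ} (hσ : σ.Good h r) (hr : r + 2 * b ≤ R)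
    (st : A.State) :
    expect (idealRun hV h s A b σ st) f ≤
      avg t s σ (fun lam => expect (A.run (cliqueGraph hV h lam).oracle b st) f) +
        b * (3 * δ) := by
  induction b generalizing σ r st with
  | zero =>
    rw [show (fun lam : V → Option (Fin t) => expect (A.run (cliqueGraph hV h lam).oracle 0 st) f) =
      fun _ => expect (idealRun hV h s A 0 σ st) f from rfl, avg_const hP (hσ.mono hr)]
    exact le_self_add
  | succ b ih =>
    have hσR : σ.Good h R := hσ.mono (by omega)
    have hrV : r + 1 < V.card := lt_of_le_of_lt (by omega) hP.add_one_lt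
    simp only [QueryAlgorithm.run, idealRun, expect_bind]
    refine expect_le_avg _ fun act => ?_
    cases act with
    | output x =>
      simp only [avg_const hP hσR]
      exact le_self_add
    | query q next =>
      simp only [expect_bind]
      calc _ ≤ expect (ideal hV h s σ q) (fun p => avg t s p.2 (fun lam =>
            expect (A.run (cliqueGraph hV h lam).oracle b (next p.1)) f) + b * (3 * δ)) :=
            expect_mono_of_support fun p hp =>
              ih (good_of_mem_support_ideal hσ hrV hp) (by omega) _
        _ ≤ (avg t s σ (fun lam => expect ((cliqueGraph hV h lam).oracle q) fun a =>
              expect (A.run (cliqueGraph hV h lam).oracle b (next a)) f) + 3 * δ) +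
              b * (3 * δ) := by
            rw [expect_add, expect_const]
            gcongr
            exact ideal_le hP hσ (by omega) q
              (fun a lam => expect (A.run (cliqueGraph hV h lam).oracle b (next a)) f)
              fun a lam => expect_le_one _ hf
        _ = _ := by
            push_cast
            ring

/-- The state in which only the hub has been seen. -/
def start (h : V) : SeenState V := ⟨{h}, fun _ => none⟩

theorem good_start (h : V) : (start h).Good h 1 where
  hub_mem := Finset.mem_singleton_self h
  hub_low := rfl
  handle_mem _ _ _ ha := by cases ha
  card_le := (Finset.card_singleton h).le

theorem toOuterMeasure_idealRun_le (hP : CliqueParams V.card t s R δ) (A : QueryAlgorithm) {b : ℕ}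
    (hb : 2 * b + 1 ≤ R) {c : ℝ} (hA : ∀ G : InputGraph V, 2 / 3 ≤ A.approxProb G b c) :
    (idealRun hV h s A b (start h) A.init).toOuterMeasure
      (some '' Set.Icc (cliqueAvgDegree V.card t s / c) (c * cliqueAvgDegree V.card t s))ᶜ ≤
        1 / 3 + b * (3 * δ) := by
  rw [← expect_indicator_one]
  refine (idealRun_le hP A (Set.indicator_le_self' fun _ _ => zero_le) (good_start h)
    (by omega) _).trans ?_
  gcongr
  refine le_trans (avg_mono fun lam hsize hlam => ?_) (hiddenAvg_const_le (1 / 3))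
  have hlow : lam h = none := (hlam.eq_none_iff h (good_start h).hub_mem).2 rfl
  have hG := hA (cliqueGraph hV h lam)
  rw [InputGraph.approxProb_eq, avgDegree_cliqueGraph hlow (Nat.zero_lt_of_lt hP.lt_s)
    (Nat.lt_of_add_left_lt hP.lt_n) hsize] at hG
  exact (expect_indicator_one _ _).trans_le (toOuterMeasure_compl_le_one_third hG)
end SeenState

theorem one_third_le_mul {V : Finset ℕ} {t₀ t₁ s R : ℕ} {δ : ℝ≥0∞}
    (hP₀ : CliqueParams V.card t₀ s R δ) (hP₁ : CliqueParams V.card t₁ s R δ)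
    (A : QueryAlgorithm) {b : ℕ} (hb : 2 * b + 1 ≤ R) {c : ℝ}
    (hgap : c * cliqueAvgDegree V.card t₀ s < cliqueAvgDegree V.card t₁ s / c)
    (hA : ∀ G : InputGraph V, 2 / 3 ≤ A.approxProb G b c) : 1 / 3 ≤ b * (6 * δ) := by
  have hV : 2 ≤ V.card := (Nat.succ_le_of_lt hP₀.add_one_lt).trans' (Nat.le_add_left 2 R)
  obtain ⟨h, hh⟩ : V.Nonempty := Finset.card_pos.1 (by omega)
  let p := SeenState.idealRun hV ⟨h, hh⟩ s A b (SeenState.start ⟨h, hh⟩) A.init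
  let S (t : ℕ) : Set (Option ℝ) :=
    some '' Set.Icc (cliqueAvgDegree V.card t s / c) (c * cliqueAvgDegree V.card t s)
  have hdisjoint : (S t₀)ᶜ ∪ (S t₁)ᶜ = Set.univ := by
    rw [← Set.compl_inter, Set.compl_univ_iff, ← Set.image_inter (Option.some_injective ℝ),
      Set.image_eq_empty]
    exact Set.eq_empty_of_forall_notMem fun x ⟨hx₀, hx₁⟩ =>
      (hx₀.2.trans_lt hgap).not_ge hx₁.1
  have hone : 1 ≤ p.toOuterMeasure (S t₀)ᶜ + p.toOuterMeasure (S t₁)ᶜ := by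
    have huniv := toOuterMeasure_add_compl p ∅
    rw [Set.compl_empty, MeasureTheory.measure_empty, zero_add, ← hdisjoint] at huniv
    exact huniv.ge.trans (MeasureTheory.measure_union_le _ _)
  have hsum : (1 / 3 + 1 / 3 + 1 / 3 : ℝ≥0∞) ≤ 1 / 3 + 1 / 3 + b * (6 * δ) :=
    calc (1 / 3 + 1 / 3 + 1 / 3 : ℝ≥0∞) = 1 := ENNReal.add_thirds 1
      _ ≤ (1 / 3 + b * (3 * δ)) + (1 / 3 + b * (3 * δ)) :=
        hone.trans (add_le_add (SeenState.toOuterMeasure_idealRun_le hP₀ A hb hA)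
          (SeenState.toOuterMeasure_idealRun_le hP₁ A hb hA))
      _ = 1 / 3 + 1 / 3 + b * (6 * δ) := by ring
  exact ENNReal.le_of_add_le_add_left (by simp [ENNReal.add_eq_top]) hsum

theorem one_le_mul_inv_add {x y : ℕ} {δ : ℝ} (hy : 0 < y) (hδ : 0 ≤ δ)
    (h : (y : ℝ) ≤ x + δ * y) : 1 ≤ (x : ℝ≥0∞) * (y : ℝ≥0∞)⁻¹ + ENNReal.ofReal δ := by
  have hy' : (0 : ℝ) < y := Nat.cast_pos.2 hy
  rw [← div_eq_mul_inv, ← ENNReal.ofReal_natCast x, ← ENNReal.ofReal_natCast y,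
    ← ENNReal.ofReal_div_of_pos hy', ← ENNReal.ofReal_add (by positivity) hδ, ENNReal.one_le_ofReal]
  calc (1 : ℝ) = y / y := (div_self hy'.ne').symm
    _ ≤ (x + δ * y) / y := by gcongr
    _ = x / y + δ := by field_simp

section ChoiceOfParams

variable {n k t C r : ℕ}

theorem two_mul_add_lt (hn : k ^ 4 ≤ n) (ht : t ≤ C * k) (hk : 4 * C + 100 ≤ k) :
    2 * k + t * k ^ 2 < n := by
  have hk3 : k ≤ k ^ 3 := Nat.le_self_pow (by norm_num) k
  calc 2 * k + t * k ^ 2 ≤ 2 * k + C * k * k ^ 2 := by gcongr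
    _ = 2 * k + C * k ^ 3 := by ring
    _ < (4 * C + 100) * k ^ 3 := by nlinarith
    _ ≤ k * k ^ 3 := by gcongr
    _ = k ^ 4 := by ring
    _ ≤ n := hn

theorem one_le_low (hn : k ^ 4 ≤ n) (ht : t ≤ C * k) (hk : 4 * C + 100 ≤ k) (hr : r ≤ 2 * k) :
    1 ≤ ((n - t * k ^ 2 - r : ℕ) : ℝ≥0∞) * ((n - r : ℕ) : ℝ≥0∞)⁻¹ +
      ENNReal.ofReal ((2 * C + 76) / k) := by
  have hlt := two_mul_add_lt hn ht hk
  refine one_le_mul_inv_add (by omega) (by positivity) ?_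
  have hk3 : 4 ≤ k ^ 3 := (show 4 ≤ k by omega).trans (Nat.le_self_pow (by norm_num) k)
  rw [Nat.cast_sub (by omega), Nat.cast_sub (by omega), Nat.cast_sub (by omega)]
  push_cast
  rify at hn ht hk hr hk3
  have hk0 : (0 : ℝ) < k := by linarith [C.cast_nonneg (α := ℝ)]
  have hhalf : (k : ℝ) ^ 4 / 2 ≤ n - r := by nlinarith
  have hmain : (t : ℝ) * (k : ℝ) ^ 2 ≤ (2 * (C : ℝ) + 76) / (k : ℝ) * ((n : ℝ) - (r : ℝ)) :=
    calc (t : ℝ) * (k : ℝ) ^ 2 ≤ C * k * (k : ℝ) ^ 2 := by gcongr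
      _ ≤ (C + 38) * k * (k : ℝ) ^ 2 := by gcongr; linarith
      _ = (2 * C + 76) / k * ((k : ℝ) ^ 4 / 2) := by field_simp; ring
      _ ≤ _ := by gcongr
  linarith

theorem one_le_nbr (hk : 4 ≤ k) (hr : r ≤ 2 * k) :
    1 ≤ ((k ^ 2 : ℕ) : ℝ≥0∞)⁻¹ * ((k ^ 2 - r : ℕ) : ℝ≥0∞) +
      ENNReal.ofReal ((2 * C + 76) / k) := by
  have hrk : r ≤ k ^ 2 := by nlinarith
  rw [mul_comm]
  refine one_le_mul_inv_add (by positivity) (by positivity) ?_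
  rw [Nat.cast_sub hrk]
  push_cast
  rify at hr
  have hδ : (2 * C + 76 : ℝ) / k * (k : ℝ) ^ 2 = 2 * C * k + 76 * k := by field_simp
  have hCk : (0 : ℝ) ≤ C * k := by positivity
  linarith [k.cast_nonneg (α := ℝ)]

theorem inv_le_ofReal (hk : 0 < k) (hkt : k ≤ t) :
    (t : ℝ≥0∞)⁻¹ ≤ ENNReal.ofReal ((2 * C + 76) / k) := by
  rify at hk hkt
  have ht : (0 : ℝ) < t := hk.trans_le hkt
  rw [← ENNReal.ofReal_natCast, ← ENNReal.ofReal_inv_of_pos ht, inv_eq_one_div]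
  gcongr
  linarith [C.cast_nonneg (α := ℝ)]

theorem mul_cliqueAvgDegree (hn : 0 < n) (t s : ℕ) :
    n * cliqueAvgDegree n t s = 2 * n + t * s * s - t * s - 2 := by
  rw [cliqueAvgDegree]
  field_simp

theorem half_le_mul_cliqueAvgDegree (hn : 0 < n) (hk : 2 ≤ k) (t : ℕ) :
    (t * k ^ 4 / 2 : ℝ) ≤ n * cliqueAvgDegree n t (k ^ 2) := by
  rw [mul_cliqueAvgDegree hn]
  push_cast
  have hn1 : (1 : ℝ) ≤ n := mod_cast hn
  have hk2 : (2 : ℝ) ≤ k ^ 2 := mod_cast hk.trans (Nat.le_self_pow two_ne_zero k)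
  have hsquare : (t : ℝ) * k ^ 2 * 2 ≤ t * k ^ 2 * k ^ 2 := by gcongr
  linarith

theorem mul_cliqueAvgDegree_le (hn₀ : 0 < n) (hn : n ≤ 16 * k ^ 4) (t : ℕ) :
    (n * cliqueAvgDegree n t (k ^ 2) : ℝ) ≤ 32 * k ^ 4 + t * k ^ 4 := by
  rw [mul_cliqueAvgDegree hn₀]
  push_cast
  rify at hn
  have htk : (0 : ℝ) ≤ t * k ^ 2 := by positivity
  linarith

theorem pow_four_le_add (hr : r ≤ 2 * k) (hk : 1 ≤ k) :
    (k ^ 4 : ℝ) ≤ (k ^ 2 - r) * (k ^ 2 - (r + 1)) + 5 * k ^ 3 := by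
  rify at hr hk
  have hmid : (k : ℝ) ^ 2 * (2 * r + 1) ≤ k ^ 2 * (5 * k) := by
    gcongr
    linarith
  have hlow : (0 : ℝ) ≤ r * (r + 1) := by positivity
  linarith

theorem one_le_edge (hn₀ : k ^ 4 ≤ n) (hn : n ≤ 16 * k ^ 4) (hkt : k ≤ t) (hk : 4 ≤ k)
    (hr : r ≤ 2 * k) :
    1 ≤ ((2 * n + t * k ^ 2 * k ^ 2 - t * k ^ 2 - 2 : ℕ) : ℝ≥0∞)⁻¹ *
      ((t * ((k ^ 2 - r) * (k ^ 2 - (r + 1))) : ℕ) : ℝ≥0∞) +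
        ENNReal.ofReal ((2 * C + 76) / k) := by
  have hn2 : 2 < n := calc
    2 < k := by omega
    _ ≤ k ^ 4 := Nat.le_self_pow four_ne_zero k
    _ ≤ n := hn₀
  have hnpos : 0 < n := Nat.zero_lt_of_lt hn2
  have hrk : r + 1 ≤ k ^ 2 := by nlinarith
  have hsub : t * k ^ 2 ≤ t * k ^ 2 * k ^ 2 := Nat.le_mul_of_pos_right _ (by positivity)
  have hM : ((2 * n + t * k ^ 2 * k ^ 2 - t * k ^ 2 - 2 : ℕ) : ℝ) =
      n * cliqueAvgDegree n t (k ^ 2) := by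
    rw [mul_cliqueAvgDegree hnpos, Nat.cast_sub (by omega), Nat.cast_sub (by omega)]
    push_cast
    rfl
  rw [mul_comm]
  refine one_le_mul_inv_add (by omega) (by positivity) ?_
  rw [hM]
  push_cast [Nat.cast_sub hrk, Nat.cast_sub (Nat.le_of_succ_le hrk)]
  calc (n * cliqueAvgDegree n t (k ^ 2) : ℝ)
    _ ≤ 32 * k ^ 4 + t * k ^ 4 := mul_cliqueAvgDegree_le hnpos hn t
    _ ≤ 32 * (t * k ^ 3) + t * ((k ^ 2 - r) * (k ^ 2 - (r + 1)) + 5 * k ^ 3) := by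
      have hk4 : (k : ℝ) ^ 4 ≤ t * k ^ 3 := by
        rw [pow_succ' (k : ℝ) 3]
        gcongr
      gcongr
      exact pow_four_le_add hr (by omega)
    _ ≤ t * ((k ^ 2 - r) * (k ^ 2 - (r + 1))) + (C + 38) * (t * k ^ 3) := by
      have hCtk : (0 : ℝ) ≤ (C + 1) * (t * k ^ 3) := by positivity
      linarith
    _ = t * ((k ^ 2 - r) * (k ^ 2 - (r + 1))) + (2 * C + 76) / k * (t * k ^ 4 / 2) := by
      field_simp
      ring
    _ ≤ t * ((k ^ 2 - r) * (k ^ 2 - (r + 1))) +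
        (2 * C + 76) / k * (n * cliqueAvgDegree n t (k ^ 2)) := by
      gcongr
      exact half_le_mul_cliqueAvgDegree hnpos (by omega) t

theorem cliqueParams (hn₀ : k ^ 4 ≤ n) (hn : n ≤ 16 * k ^ 4) (hkt : k ≤ t) (htC : t ≤ C * k)
    (hk : 4 * C + 100 ≤ k) :
    CliqueParams n t (k ^ 2) (2 * k) (ENNReal.ofReal ((2 * C + 76) / k)) where
  t_pos := by omega
  lt_s := by nlinarith
  lt_n := two_mul_add_lt hn₀ htC hk
  low _ hr := one_le_low hn₀ htC hk hr
  nbr _ hr := one_le_nbr (by omega) hr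
  pair := inv_le_ofReal (by omega) hkt
  edge _ hr := one_le_edge hn₀ hn hkt (by omega) hr

theorem mul_cliqueAvgDegree_lt_div {c : ℝ} (hc : 1 ≤ c) (hC : 4 * c ^ 2 < C) (hk : 32 ≤ k)
    (hn₀ : 0 < n) (hn : n ≤ 16 * k ^ 4) :
    c * cliqueAvgDegree n k (k ^ 2) < cliqueAvgDegree n (C * k) (k ^ 2) / c := by
  have hn' : (0 : ℝ) < n := Nat.cast_pos.2 hn₀
  rw [lt_div_iff₀ (by linarith), mul_right_comm, ← sq]
  refine lt_of_mul_lt_mul_left ?_ hn'.le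
  have hk32 : (32 : ℝ) ≤ k := mod_cast hk
  calc n * (c ^ 2 * cliqueAvgDegree n k (k ^ 2))
    _ = c ^ 2 * (n * cliqueAvgDegree n k (k ^ 2)) := by ring
    _ ≤ c ^ 2 * (32 * k ^ 4 + k * k ^ 4) := by
      gcongr
      exact mul_cliqueAvgDegree_le hn₀ hn k
    _ ≤ c ^ 2 * (k * k ^ 4 + k * k ^ 4) := by gcongr
    _ = 4 * c ^ 2 * (k ^ 5 / 2) := by ring
    _ < C * (k ^ 5 / 2) := by gcongr
    _ = (C * k : ℕ) * k ^ 4 / 2 := by push_cast; ring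
    _ ≤ n * cliqueAvgDegree n (C * k) (k ^ 2) :=
      half_le_mul_cliqueAvgDegree hn₀ (by omega) (C * k)

end ChoiceOfParams

theorem le_mul_of_two_thirds_le_approxProb {V : Finset ℕ} {k C : ℕ} {c : ℝ} (hc : 1 ≤ c)
    (hC : 4 * c ^ 2 < C) (hk : 4 * C + 100 ≤ k) (hV₀ : k ^ 4 ≤ V.card)
    (hV : V.card ≤ 16 * k ^ 4) (A : QueryAlgorithm) {b : ℕ}
    (hA : ∀ G : InputGraph V, 2 / 3 ≤ A.approxProb G b c) : (k : ℝ) ≤ 18 * (2 * C + 76) * b := by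
  have hk0 : (0 : ℝ) < k := Nat.cast_pos.2 (by omega)
  obtain hbk | hkb := lt_or_ge b k
  · have hCpos : 1 ≤ C := Nat.cast_pos.1 ((by positivity : 0 ≤ 4 * c ^ 2).trans_lt hC)
    have hkCk : k ≤ C * k := Nat.le_mul_of_pos_left k hCpos
    have hVpos : 0 < V.card := (Nat.pow_pos (by omega)).trans_le hV₀
    have hprob := one_third_le_mul (cliqueParams hV₀ hV le_rfl hkCk hk)
      (cliqueParams hV₀ hV hkCk le_rfl hk) A (by omega)
      (mul_cliqueAvgDegree_lt_div hc hC (by omega) hVpos hV) hA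
    have hreal : (1 / 3 : ℝ) ≤ b * (6 * ((2 * C + 76) / k)) := by
      refine (ENNReal.ofReal_le_ofReal_iff (by positivity)).1 ?_
      rw [ENNReal.ofReal_mul (by positivity), ENNReal.ofReal_mul (by positivity),
        ENNReal.ofReal_div_of_pos (by positivity), ENNReal.ofReal_natCast]
      simpa using hprob
    calc (k : ℝ) = 1 / 3 * (3 * k) := by ring
      _ ≤ b * (6 * ((2 * C + 76) / k)) * (3 * k) := by gcongr
      _ = 18 * (2 * C + 76) * b := by field_simp; ring
  · calc (k : ℝ) ≤ 1 * b := by rw [one_mul]; exact_mod_cast hkb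
      _ ≤ 18 * (2 * C + 76) * b := by
        gcongr
        linarith [C.cast_nonneg (α := ℝ)]

theorem rpow_one_fourth_pow_four {x : ℝ} (hx : 0 ≤ x) : (x ^ (1 / 4 : ℝ)) ^ 4 = x := by
  rw [one_div]
  exact_mod_cast Real.rpow_inv_natCast_pow hx four_ne_zero

theorem avgDegree_lowerBound (c : ℝ) (hc : 1 ≤ c) :
    ∃ (κ : ℝ) (n₀ : ℕ), 0 < κ ∧ ∀ n : ℕ, n₀ ≤ n → ∀ V : Finset ℕ, V.card = n →
      ∀ (A : QueryAlgorithm) (b : ℕ), (∀ G : InputGraph V, 2 / 3 < A.approxProb G b c) →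
        κ * (n : ℝ) ^ (1 / 4 : ℝ) ≤ b := by
  obtain ⟨C, hC⟩ := exists_nat_gt (4 * c ^ 2)
  refine ⟨1 / (36 * (2 * C + 76)), (4 * C + 100) ^ 4, by positivity, ?_⟩
  rintro n hn V rfl A b hA
  let x : ℝ := (V.card : ℝ) ^ (1 / 4 : ℝ)
  have hx₀ : 0 ≤ x := by positivity
  have hx₄ : x ^ 4 = V.card := rpow_one_fourth_pow_four (Nat.cast_nonneg _)
  have hkx : (⌊x⌋₊ : ℝ) ≤ x := Nat.floor_le hx₀
  have hk : 4 * C + 100 ≤ ⌊x⌋₊ := by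
    refine Nat.le_floor (le_of_pow_le_pow_left₀ four_ne_zero hx₀ ?_)
    rw [hx₄]
    exact_mod_cast hn
  have hx : x ≤ 2 * ⌊x⌋₊ := by
    have hone : (1 : ℝ) ≤ ⌊x⌋₊ := Nat.one_le_cast.2 (by omega)
    linarith [Nat.lt_floor_add_one x]
  have hV₀ : (⌊x⌋₊ : ℝ) ^ 4 ≤ V.card := by rw [← hx₄]; gcongr
  have hV : (V.card : ℝ) ≤ 16 * (⌊x⌋₊ : ℝ) ^ 4 :=
    calc (V.card : ℝ) = x ^ 4 := hx₄.symm
      _ ≤ (2 * ⌊x⌋₊) ^ 4 := by gcongr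
      _ = _ := by ring
  have hkb := le_mul_of_two_thirds_le_approxProb hc hC hk (mod_cast hV₀) (mod_cast hV) A
    fun G => (hA G).le
  rw [one_div_mul_eq_div, div_le_iff₀ (by positivity)]
  linarith

end

theorem theorem1p1 :
    -- (a) the algorithm may depend on the number `n` of vertices and on `ε`, but not on the
    -- vertex identifiers or the graph
    (∃ (A : ℕ → ℝ → QueryAlgorithm) (C : ℝ) (k : ℕ), 0 < C ∧
      ∀ (n : ℕ) (ε : ℝ), 0 < ε → ε < 1 →
        ∀ (V : Finset ℕ), V.card = n → ∀ G : InputGraph V,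
          99 / 100 < (A n ε).approxProb G
            ⌊C * Real.log n ^ k * (ε ^ 2)⁻¹ *
              min G.avgDegree ((n / G.avgDegree) ^ (1 / 3 : ℝ))⌋₊ (1 + ε) ∧
          99 / 100 < (A n ε).approxProb G
            ⌊C * Real.log n ^ k * (ε ^ 2)⁻¹ * (n : ℝ) ^ (1 / 4 : ℝ)⌋₊ (1 + ε)) ∧
    -- (b) even if the algorithm depends on the set `V` of vertex identifiers
    (∀ c : ℝ, 1 ≤ c → ∃ (κ : ℝ) (n₀ : ℕ), 0 < κ ∧
      ∀ n : ℕ, n₀ ≤ n → ∀ V : Finset ℕ, V.card = n →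
        ∀ (A : QueryAlgorithm) (b : ℕ),
          (∀ G : InputGraph V, 2 / 3 < A.approxProb G b c) →
            κ * (n : ℝ) ^ (1 / 4 : ℝ) ≤ b) :=
  ⟨exists_avgDegree_algorithm, avgDegree_lowerBound⟩
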